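/- Let $k\ge l\ge 1$ and fix a maximal triangulation (a subdivision into standard triangles) of the trapezoid with vertices $(0,0),(0,1),(k,0),(l,1)$; such triangulations correspond to the crepant resolutions of the generalized conifold $\{xy=z^kw^l\}$. Let $X$ be the smooth complete toric threefold whose fan has the rays generated by $(i,0,1)$ $(0\le i\le k)$, $(j,1,1)$ $(0\le j\le l)$, $(0,0,-1)$, $(0,-1,-1)$, $(1,0,0)$, $(-1,0,0)$ and the following maximal cones: the cones over the triangles placed at height $1$; the cones generated by $(-1,0,0),(0,0,1),(0,1,1)$ and by $(1,0,0),(k,0,1),(l,1,1)$; the cones generated by $(0,-1,-1)$ together with $\{(i-1,0,1),(i,0,1)\}$ $(1\le i\le k)$, $\{(-1,0,0),(0,0,1)\}$ or $\{(1,0,0),(k,0,1)\}$; the cones generated by $(0,0,-1)$ together with $\{(j-1,1,1),(j,1,1)\}$ $(1\le j\le l)$, $\{(-1,0,0),(0,1,1)\}$ or $\{(1,0,0),(l,1,1)\}$; and the cones generated by $(0,0,-1),(0,-1,-1)$ and $(\pm1,0,0)$. Let $z,w:X\to\mathbb P^1$ be the toric functions of the dual lattice points $(0,-1,1)$ and $(0,1,0)$.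 Let $\omega$ be a toric (that is, invariant under the compact torus $T^3$) Kähler form on $X$, and let $\pi_{T^1}:X\to\mathbb R$ be a moment map of the Hamiltonian $T^1$-action given by the vector $(1,0,0)$. The image $I$ of $\pi_{T^1}$ is a compact interval $[c,d]$ with $c<d$. Put $B=[-\infty,\infty]^2\times I$ and $$\pi:X\to B,\qquad \pi=(b_1,b_2,b_3)=(\log|z-1|,\ \log|w-1|,\ \pi_{T^1}).$$ Here $B$ is a manifold with corners, where $[-\infty,\infty]$ is identified with $[0,1]$ by $b\mapsto e^{2b}/(1+e^{2b})$, and the discriminant locus of $\pi$ is its set of critical values. Then $\pi_{T^1}$ is constant, with value $s_i$, on the closed toric stratum of the cone generated by $(i-1,0,1),(i,0,1)$ for $1\le i\le k$, and constant, with value $t_j$, on the closed toric stratum of the cone generated by $(j-1,1,1),(j,1,1)$ for $1\le j\le l$. The $k+l$ numbers $s_1,\dots,s_k,t_1,\dots,t_l$ are distinct, and they are exactly the critical values of $\pi_{T^1}$ in the interior of $I$. The discriminant locus of $\pi$ is $$\partial B\ \cup\ \bigcup_{i=1}^k\{b\in B: b_1=0,\ b_3=s_i\}\ \cup\ \bigcup_{j=1}^l\{b\in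 B: b_2=0,\ b_3=t_j\}.$$ -/

import Mathlib

open Set Filter Topology

noncomputable section

namespace DoubledGross

/-! ### The trapezoid and its maximal triangulations -/

/-- The lattice points of the trapezoid with vertices `(0,0), (0,1), (k,0), (l,1)`:
`inl i` is `(i,0)` for `0 ≤ i ≤ k` and `inr j` is `(j,1)` for `0 ≤ j ≤ l`. -/
abbrev Vertex (k l : ℕ) : Type := Fin (k + 1) ⊕ Fin (l + 1)

/-- The lattice point, as an element of `ℤ²`. -/
def Vertex.coord {k l : ℕ} : Vertex k l → ℤ × ℤ
  | Sum.inl i => (((i : ℕ) : ℤ), 0)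
  | Sum.inr j => (((j : ℕ) : ℤ), 1)

/-- The lattice point, as a point of the plane. -/
def Vertex.toPlane {k l : ℕ} (v : Vertex k l) : ℝ × ℝ :=
  ((v.coord.1 : ℝ), (v.coord.2 : ℝ))

/-- The trapezoid `Δ_{k,l}`. -/
def trapezoid (k l : ℕ) : Set (ℝ × ℝ) :=
  convexHull ℝ {((0 : ℝ), (0 : ℝ)), (0, 1), ((k : ℝ), 0), ((l : ℝ), 1)}

/-- Three lattice points span a standard triangle: the image of the convex hull of
`(0,0), (1,0), (0,1)` under an element of `ℤ² ⋊ GL(2,ℤ)`. -/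
def IsStandardTriangle {k l : ℕ} (t : Finset (Vertex k l)) : Prop :=
  ∃ a b c : Vertex k l, t = {a, b, c} ∧
    |(b.coord.1 - a.coord.1) * (c.coord.2 - a.coord.2)
      - (b.coord.2 - a.coord.2) * (c.coord.1 - a.coord.1)| = 1

/-- The triangle in the plane spanned by a set of lattice points. -/
def hull {k l : ℕ} (t : Finset (Vertex k l)) : Set (ℝ × ℝ) :=
  convexHull ℝ (Vertex.toPlane '' (t : Set (Vertex k l)))

/-- A maximal triangulation of the trapezoid `Δ_{k,l}`, that is, a subdivision into standard
triangles any two of which meet in a common (possibly empty) face. Such triangulations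
correspond to the crepant resolutions of the generalized conifold. -/
structure MaximalTriangulation (k l : ℕ) where
  triangles : Finset (Finset (Vertex k l))
  standard : ∀ t ∈ triangles, IsStandardTriangle t
  cover : ⋃ t ∈ triangles, hull t = trapezoid k l
  face_to_face : ∀ t ∈ triangles, ∀ t' ∈ triangles, hull t ∩ hull t' = hull (t ∩ t')

/-! ### The fan of the compactified resolved generalized conifold -/

/-- The rays of the fan, in bijection with the toric prime divisors. -/
inductive Ray (k l : ℕ) : Type
  | vertex (v : Vertex k l)
  | zInf
  | wInf
  | xiZero
  | xiInf
  deriving DecidableEq, Fintype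

namespace Ray

/-- The ray through `(i,0,1)`; its divisor lies in `{z = 0}`. -/
abbrev bot {k l : ℕ} (i : Fin (k + 1)) : Ray k l := vertex (Sum.inl i)

/-- The ray through `(j,1,1)`; its divisor lies in `{w = 0}`. -/
abbrev top {k l : ℕ} (j : Fin (l + 1)) : Ray k l := vertex (Sum.inr j)

/-- The primitive generator of a ray in the lattice `N = ℤ³`. -/
def gen {k l : ℕ} : Ray k l → Fin 3 → ℤ
  | vertex v => ![v.coord.1, v.coord.2, 1]
  | zInf => ![0, 0, -1]
  | wInf => ![0, -1, -1]
  | xiZero => ![1, 0, 0]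
  | xiInf => ![-1, 0, 0]

/-- The pairing of `m` in the dual lattice `M = ℤ³` with the generator of a ray. -/
def pairing {k l : ℕ} (m : Fin 3 → ℤ) (ρ : Ray k l) : ℤ := ∑ i, m i * ρ.gen i

end Ray

variable {k l : ℕ}

/-- The maximal cones of the fan, each given by its three rays. Forgetting the first coordinate of
`ℤ³` maps this fan to the fan of `ℙ¹ × ℙ¹` with rays `(0,1), (1,1), (0,-1), (-1,-1)`; the cones are
listed according to the maximal cone of that fan in which they lie. -/
inductive IsMaxCone (T : MaximalTriangulation k l) : Finset (Ray k l) → Prop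
  /-- the cones over the triangles, and the two cones next to the strip -/
  | triangle (t : Finset (Vertex k l)) (ht : t ∈ T.triangles) : IsMaxCone T (t.image Ray.vertex)
  | left : IsMaxCone T {Ray.xiInf, Ray.bot 0, Ray.top 0}
  | right : IsMaxCone T {Ray.xiZero, Ray.bot (Fin.last k), Ray.top (Fin.last l)}
  /-- the cones containing `(0,-1,-1)` and some `(i,0,1)` -/
  | botEdge (i : Fin k) : IsMaxCone T {Ray.bot i.castSucc, Ray.bot i.succ, Ray.wInf}
  | botLeft : IsMaxCone T {Ray.xiInf, Ray.bot 0, Ray.wInf}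
  | botRight : IsMaxCone T {Ray.xiZero, Ray.bot (Fin.last k), Ray.wInf}
  /-- the cones containing `(0,0,-1)` and some `(j,1,1)` -/
  | topEdge (j : Fin l) : IsMaxCone T {Ray.top j.castSucc, Ray.top j.succ, Ray.zInf}
  | topLeft : IsMaxCone T {Ray.xiInf, Ray.top 0, Ray.zInf}
  | topRight : IsMaxCone T {Ray.xiZero, Ray.top (Fin.last l), Ray.zInf}
  /-- the cones containing `(0,0,-1)` and `(0,-1,-1)` -/
  | infLeft : IsMaxCone T {Ray.xiInf, Ray.zInf, Ray.wInf}
  | infRight : IsMaxCone T {Ray.xiZero, Ray.zInf, Ray.wInf}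

/-- The type of maximal cones. -/
abbrev MaxCone (T : MaximalTriangulation k l) : Type := {σ : Finset (Ray k l) // IsMaxCone T σ}

/-! ### The toric variety, in homogeneous coordinates -/

/-- The vectors of homogeneous coordinates: the rays whose coordinate vanishes lie in a common
cone of the fan. -/
abbrev HomogCoord (T : MaximalTriangulation k l) : Type :=
  {u : Ray k l → ℂ // ∃ σ : MaxCone T, ∀ ρ, u ρ = 0 → ρ ∈ σ.1}

/-- The group `{ g ∈ (ℂˣ)^rays : ∏ g_ρ ^ ⟨m, ρ⟩ = 1 for all m ∈ M }`, by which the space of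
homogeneous coordinates is divided. -/
def coxGroup (k l : ℕ) : Subgroup (Ray k l → ℂˣ) where
  carrier := {g | ∀ m : Fin 3 → ℤ, ∏ ρ, g ρ ^ Ray.pairing m ρ = 1}
  one_mem' := by intro m; simp
  mul_mem' := by
    intro a b ha hb m
    have h1 := ha m
    have h2 := hb m
    simp only [Pi.mul_apply, mul_zpow, Finset.prod_mul_distrib, h1, h2, mul_one]
  inv_mem' := by
    intro a ha m
    have h1 := ha m
    simp only [Pi.inv_apply, inv_zpow, Finset.prod_inv_distrib, h1, inv_one]

/-- Two vectors of homogeneous coordinates describe the same point. -/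
instance coxSetoid (T : MaximalTriangulation k l) : Setoid (HomogCoord T) where
  r u v := ∃ g ∈ coxGroup k l, ∀ ρ, v.1 ρ = (g ρ : ℂ) * u.1 ρ
  iseqv :=
    { refl := fun u => ⟨1, one_mem _, fun ρ => by simp⟩
      symm := by
        rintro u v ⟨g, hg, h⟩
        exact ⟨g⁻¹, inv_mem hg, fun ρ => by simp [h ρ]⟩
      trans := by
        rintro u v w ⟨g, hg, h⟩ ⟨g', hg', h'⟩
        exact ⟨g' * g, mul_mem hg' hg, fun ρ => by simp [h ρ, h' ρ, mul_assoc]⟩ }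

/-- The compactified resolved generalized conifold: the smooth complete toric threefold of the
above fan, as the quotient of the space of homogeneous coordinates. -/
def ToricVariety (T : MaximalTriangulation k l) : Type := Quotient (coxSetoid T)

/-- The point with given homogeneous coordinates. -/
def toPoint {T : MaximalTriangulation k l} (u : HomogCoord T) : ToricVariety T :=
  Quotient.mk (coxSetoid T) u

/-- The toric prime divisor of a ray. -/
def toricDivisor (T : MaximalTriangulation k l) (ρ : Ray k l) : Set (ToricVariety T) :=
  {p | ∃ u : HomogCoord T, toPoint u = p ∧ u.1 ρ = 0}

/-- The coordinate space `ℂ^σ ≅ ℂ³` of the affine toric chart of a maximal cone. -/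
abbrev ChartSpace {T : MaximalTriangulation k l} (σ : MaxCone T) : Type := {ρ // ρ ∈ σ.1} → ℂ

/-- The affine toric chart of a maximal cone: the coordinates outside the cone are `1`. These charts
are injective, cover the variety and define its structure of a complex manifold. -/
def chart {T : MaximalTriangulation k l} (σ : MaxCone T) (x : ChartSpace σ) : ToricVariety T :=
  toPoint ⟨fun ρ => if h : ρ ∈ σ.1 then x ⟨ρ, h⟩ else 1, σ, fun ρ h0 => by
    by_contra h
    simp [h] at h0⟩

/-- The action of the compact torus. The tuple `c` acts by multiplying the homogeneous coordinates;
the action factors through the compact torus `N ⊗ U(1) = T³`, and the circle of a single ray `ρ` acts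
as the one-parameter subgroup of `ρ.gen`. -/
def torusAct {T : MaximalTriangulation k l} (c : Ray k l → Circle) :
    ToricVariety T → ToricVariety T :=
  Quotient.map' (fun u => ⟨fun ρ => (c ρ : ℂ) * u.1 ρ, by
      obtain ⟨σ, hσ⟩ := u.2
      refine ⟨σ, fun ρ h => hσ ρ ?_⟩
      simpa using h⟩) (by
    rintro u v ⟨g, hg, h⟩
    exact ⟨g, hg, fun ρ => by simp only [h ρ]; ring⟩)

/-- The circle action of the vector `(1,0,0)`. -/
def circleAct {T : MaximalTriangulation k l} (c : Circle) : ToricVariety T → ToricVariety T :=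
  torusAct (Function.update 1 Ray.xiZero c)

/-- The toric rational function of the lattice point `m` of the dual lattice, with value `∞` where its
denominator vanishes. (It is used only for characters whose zeros and poles are disjoint.) -/
def toricFunction {T : MaximalTriangulation k l} (m : Fin 3 → ℤ) : ToricVariety T → OnePoint ℂ :=
  Quotient.lift (fun u : HomogCoord T =>
    if ∏ ρ, u.1 ρ ^ (-Ray.pairing m ρ).toNat = 0 then OnePoint.infty
    else (((∏ ρ, u.1 ρ ^ (Ray.pairing m ρ).toNat) /
      ∏ ρ, u.1 ρ ^ (-Ray.pairing m ρ).toNat : ℂ) : OnePoint ℂ)) (by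
    rintro u v ⟨g, hg, h⟩
    have key : (∏ ρ, (g ρ : ℂ) ^ (Ray.pairing m ρ).toNat)
        = ∏ ρ, (g ρ : ℂ) ^ (-Ray.pairing m ρ).toNat := by
      have h1 : ∏ ρ, g ρ ^ Ray.pairing m ρ = 1 := hg m
      have h2 : (∏ ρ, g ρ ^ (Ray.pairing m ρ).toNat)
          = ∏ ρ, g ρ ^ (-Ray.pairing m ρ).toNat := by
        rw [← div_eq_one, ← Finset.prod_div_distrib, ← h1]
        refine Finset.prod_congr rfl fun ρ _ => ?_
        rw [← zpow_natCast, ← zpow_natCast, div_eq_mul_inv, ← zpow_sub]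
        congr 1
        omega
      have h3 := congrArg (Units.val : ℂˣ → ℂ) h2
      simpa using h3
    have hne : (∏ ρ, (g ρ : ℂ) ^ (-Ray.pairing m ρ).toNat) ≠ 0 :=
      Finset.prod_ne_zero_iff.2 fun ρ _ => pow_ne_zero _ (g ρ).ne_zero
    simp only [h, mul_pow, Finset.prod_mul_distrib, key, mul_eq_zero, hne, false_or,
      mul_div_mul_left _ _ hne])

/-- The toric function `z`, of the lattice point `(0,-1,1)`. -/
def zFun {T : MaximalTriangulation k l} : ToricVariety T → OnePoint ℂ := toricFunction ![0, -1, 1]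

/-- The toric function `w`, of the lattice point `(0,1,0)`. -/
def wFun {T : MaximalTriangulation k l} : ToricVariety T → OnePoint ℂ := toricFunction ![0, 1, 0]

/-! ### Calculus on the toric variety -/

/-- A critical point of a map to a normed space: its differential, computed in a chart, is not
surjective. -/
def IsCriticalPoint {T : MaximalTriangulation k l} {F : Type*} [NormedAddCommGroup F]
    [NormedSpace ℝ F] (f : ToricVariety T → F) (p : ToricVariety T) : Prop :=
  ∃ (σ : MaxCone T) (x : ChartSpace σ), chart σ x = p ∧
    ¬ Function.Surjective (fderiv ℝ (fun y => f (chart σ y)) x)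

/-- The critical values of a map to a normed space. -/
def criticalValues {T : MaximalTriangulation k l} {F : Type*} [NormedAddCommGroup F]
    [NormedSpace ℝ F] (f : ToricVariety T → F) : Set F :=
  f '' {p | IsCriticalPoint f p}

/-- A family of real 2-forms, one on each affine toric chart. -/
abbrev ChartForms (T : MaximalTriangulation k l) : Type :=
  (σ : MaxCone T) → ChartSpace σ → (ChartSpace σ) [⋀^Fin 2]→L[ℝ] ℝ

/-- The map `Φ` of the toric variety pulls the 2-form back to itself. Here `φ` runs over the
coordinate expressions of `Φ`. For `Φ = id` this says that the forms on the charts agree on overlaps,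
so that they define a 2-form on the variety. -/
def PreservedBy {T : MaximalTriangulation k l} (ω : ChartForms T)
    (Φ : ToricVariety T → ToricVariety T) : Prop :=
  ∀ (σ τ : MaxCone T) (φ : ChartSpace σ → ChartSpace τ) (x : ChartSpace σ),
    (∀ᶠ y in 𝓝 x, chart τ (φ y) = Φ (chart σ y)) → DifferentiableAt ℝ φ x →
    ∀ v w : ChartSpace σ, ω τ (φ x) ![fderiv ℝ φ x v, fderiv ℝ φ x w] = ω σ x ![v, w]

/-- A toric Kähler form: a smooth closed positive real (1,1)-form that is invariant under the
compact torus. -/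
structure ToricKahlerForm (T : MaximalTriangulation k l) where
  form : ChartForms T
  compatible : PreservedBy form id
  smooth : ∀ σ, ContDiff ℝ ((⊤ : ℕ∞) : WithTop ℕ∞) (form σ)
  closed : ∀ σ x, extDeriv (form σ) x = 0
  type_one_one : ∀ σ x (v w : ChartSpace σ),
    form σ x ![Complex.I • v, Complex.I • w] = form σ x ![v, w]
  positive : ∀ σ x (v : ChartSpace σ), v ≠ 0 → 0 < form σ x ![v, Complex.I • v]
  invariant : ∀ c : Ray k l → Circle, PreservedBy form (torusAct c)

/-- The tangent vector `ξ` at the point `x` of a chart is the value of the fundamental vector field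
`∂/∂θ` of the circle action of `(1,0,0)`. -/
def IsFundamentalVector {T : MaximalTriangulation k l} (σ : MaxCone T) (x ξ : ChartSpace σ) : Prop :=
  ∃ γ : ℝ → ChartSpace σ, γ 0 = x ∧ HasDerivAt γ ξ 0 ∧
    ∀ θ : ℝ, chart σ (γ θ) = circleAct (Circle.exp θ) (chart σ x)

/-- `μ` is a moment map of the circle action of `(1,0,0)`, with the sign for which
`ω = dμ ∧ dθ` along the orbits. -/
structure IsCircleMomentMap {T : MaximalTriangulation k l} (ω : ToricKahlerForm T)
    (μ : ToricVariety T → ℝ) : Prop where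
  smooth : ∀ σ : MaxCone T, ContDiff ℝ ((⊤ : ℕ∞) : WithTop ℕ∞) (fun x => μ (chart σ x))
  hamiltonian : ∀ (σ : MaxCone T) (x ξ : ChartSpace σ), IsFundamentalVector σ x ξ →
    ∀ v : ChartSpace σ, fderiv ℝ (fun y => μ (chart σ y)) x v = ω.form σ x ![v, ξ]

/-! ### The doubled Gross fibration and its discriminant locus -/

/-- `log |ζ - 1|`, with values in `[-∞,∞]`, on the projective line. -/
def logDistOne (ζ : OnePoint ℂ) : EReal := ζ.elim ⊤ fun a => ENNReal.log ‖a - 1‖ₑ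

/-- The doubled Gross fibration `(log |z - 1|, log |w - 1|, μ)`. -/
def fibration {T : MaximalTriangulation k l} (μ : ToricVariety T → ℝ) (p : ToricVariety T) :
    EReal × EReal × ℝ :=
  (logDistOne (zFun p), logDistOne (wFun p), μ p)

/-- The base `B = [-∞,∞]² × I`, where `I` is the image of the moment map. -/
def base {T : MaximalTriangulation k l} (μ : ToricVariety T → ℝ) : Set (EReal × EReal × ℝ) :=
  {b | b.2.2 ∈ range μ}

/-- The boundary `∂B` of the base. -/
def baseBoundary {T : MaximalTriangulation k l} (μ : ToricVariety T → ℝ) :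
    Set (EReal × EReal × ℝ) :=
  {b | b ∈ base μ ∧ (b.1 = ⊥ ∨ b.1 = ⊤ ∨ b.2.1 = ⊥ ∨ b.2.1 = ⊤ ∨ b.2.2 ∈ frontier (range μ))}

/-- The coordinate `e^{2b} / (1 + e^{2b})` on `[-∞,∞]`, which maps `[-∞,∞]` onto `[0,1]` and is a
diffeomorphism from `ℝ` to `(0,1)`. It makes `[-∞,∞]` a manifold with boundary. -/
def compactCoord : EReal → ℝ :=
  EReal.rec 0 (fun b : ℝ => Real.exp (2 * b) / (1 + Real.exp (2 * b))) 1

/-- Coordinates on the base as a manifold with corners. -/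
def baseCoord (b : EReal × EReal × ℝ) : ℝ × ℝ × ℝ :=
  (compactCoord b.1, compactCoord b.2.1, b.2.2)

/-- The discriminant locus of the fibration: the set of its critical values, that is, of the points
`b` of the base over which it is not everywhere a submersion. -/
def discriminantLocus {T : MaximalTriangulation k l} (μ : ToricVariety T → ℝ) :
    Set (EReal × EReal × ℝ) :=
  fibration μ '' {p | IsCriticalPoint (fun q => baseCoord (fibration μ q)) p}

end DoubledGross

end

open Set Filter Topology

noncomputable section

namespace DoubledGross

variable {k l : ℕ}

/-! ### Combinatorics of a maximal triangulation -/

/-! In the chart of a maximal cone the circle acts linearly, with weights the coefficients of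
$(1,0,0)$ in the basis of generators of the cone. Up to order there are two patterns: a single
nonzero weight $\pm1$, when the cone contains $(\pm1,0,0)$, or the weights $1,-1$ on two
horizontally adjacent rays. Let $\eta$ be the linear vector field with these weights (`flowVector`).
The circle is generated by $i\eta$, so the Hamiltonian equation reads $d\mu=\omega(\cdot,i\eta)$:
$\eta$ is the gradient of $\mu$ for the Kähler metric (`fderiv_eq`). Hence the critical points of
$\mu$ are the fixed points of the circle. They fill the divisors of $(\pm1,0,0)$, where $\mu$ takes
its extreme values (`mem_Icc`, `range_eq_Icc`), and the curves of the horizontal edges, on each of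
which $\mu$ is constant (`eq_of_fixed`).

The values on these curves are distinct because the triangulation is a strip of $k+l$ triangles
ordered from left to right (`exists_strip`). Each triangle has exactly one horizontal edge, whose
value is that of $\mu$ at the origin of its chart. Two successive triangles share a slanted edge,
and its toric curve joins the two origins; by `weight_mul_sub_pos` the moment map is strictly
monotone along it. So the values decrease strictly from left to right (`exists_order`).

For the discriminant, $z$ and $w$ are invariant under the complexified circle. At a point that is
not fixed, with $z$ and $w$ different from $1$ and $\infty$, one can move $z$ alone along the line
through $1$, then $w$ alone, and finally follow $\eta$, which changes $\mu$ but neither $z$ nor $w$.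
The differential is triangular with nonzero diagonal (`surjective_fderiv`). At a fixed point
$d\mu=0$, so the point is critical; on the curve of a lower edge $z=0$, so $\log|z-1|=0$, while $w$
is free, and on an upper edge the roles are exchanged. Over $\partial B$ some coordinate of the base
is extremal, so its differential vanishes. -/

theorem convex_halfPlane (α β c : ℝ) : Convex ℝ {p : ℝ × ℝ | α * p.1 + β * p.2 ≤ c} := by
  intro p hp q hq s t hs ht hst
  simp only [mem_ofPred_eq, Prod.fst_add, Prod.snd_add, Prod.smul_fst, Prod.smul_snd,
    smul_eq_mul] at *
  have h1 := mul_le_mul_of_nonneg_left hp hs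
  have h2 := mul_le_mul_of_nonneg_left hq ht
  have h3 : s * c + t * c = c := by rw [← add_mul, hst, one_mul]
  linarith

theorem hull_subset_halfPlane {t : Finset (Vertex k l)} {α β c : ℝ}
    (h : ∀ v ∈ t, α * v.toPlane.1 + β * v.toPlane.2 ≤ c) :
    hull t ⊆ {p : ℝ × ℝ | α * p.1 + β * p.2 ≤ c} := by
  refine convexHull_min ?_ (convex_halfPlane α β c)
  rintro _ ⟨v, hv, rfl⟩
  exact h v hv

@[simp] theorem toPlane_inl (i : Fin (k + 1)) :
    Vertex.toPlane (Sum.inl i : Vertex k l) = (((i : ℕ) : ℝ), (0 : ℝ)) := by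
  simp [Vertex.toPlane, Vertex.coord]

@[simp] theorem toPlane_inr (j : Fin (l + 1)) :
    Vertex.toPlane (Sum.inr j : Vertex k l) = (((j : ℕ) : ℝ), (1 : ℝ)) := by
  simp [Vertex.toPlane, Vertex.coord]

/-- `(a, b)` and `(a', b')` are the left and the right one of the two sides of a standard triangle
that join the two horizontal sides of the trapezoid. -/
def IsStep (a : Fin (k + 1)) (b : Fin (l + 1)) (a' : Fin (k + 1)) (b' : Fin (l + 1)) : Prop :=
  ((a' : ℕ) = a + 1 ∧ b' = b) ∨ (a' = a ∧ (b' : ℕ) = b + 1)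

/-- Two of the three vertices lie on the same horizontal side, and up to sign the determinant is the
difference of their abscissas. So these two are neighbours, and the third vertex lies on the other
side. -/
theorem IsStandardTriangle.exists_isStep {t : Finset (Vertex k l)} (ht : IsStandardTriangle t) :
    ∃ a b a' b', IsStep a b a' b' ∧ t = {Sum.inl a, Sum.inr b, Sum.inl a', Sum.inr b'} := by
  obtain ⟨u, v, w, rfl, h⟩ := ht
  have key1 : ∀ (x y : Fin (k + 1)) (z : Fin (l + 1)),
      ((x : ℕ) = y + 1 ∨ (y : ℕ) = x + 1) →
      ∃ a b a' b', IsStep a b a' b' ∧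
        ({Sum.inl x, Sum.inl y, Sum.inr z} : Finset (Vertex k l)) =
          {Sum.inl a, Sum.inr b, Sum.inl a', Sum.inr b'} := by
    intro x y z hxy
    rcases hxy with h | h
    · exact ⟨y, z, x, z, Or.inl ⟨h, rfl⟩, by ext q; simp; tauto⟩
    · exact ⟨x, z, y, z, Or.inl ⟨h, rfl⟩, by ext q; simp⟩
  have key2 : ∀ (x y : Fin (l + 1)) (z : Fin (k + 1)),
      ((x : ℕ) = y + 1 ∨ (y : ℕ) = x + 1) →
      ∃ a b a' b', IsStep a b a' b' ∧
        ({Sum.inr x, Sum.inr y, Sum.inl z} : Finset (Vertex k l)) =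
          {Sum.inl a, Sum.inr b, Sum.inl a', Sum.inr b'} := by
    intro x y z hxy
    rcases hxy with h | h
    · exact ⟨z, y, z, x, Or.inr ⟨rfl, h⟩, by ext q; simp; tauto⟩
    · exact ⟨z, x, z, y, Or.inr ⟨rfl, h⟩, by ext q; simp; tauto⟩
  replace h := (abs_eq zero_le_one).1 h
  rcases u with x | x <;> rcases v with y | y <;> rcases w with z | z <;>
    simp only [Vertex.coord] at h
  · omega
  · obtain ⟨a, b, a', b', h1, h2⟩ := key1 x y z (by omega)
    exact ⟨a, b, a', b', h1, by rw [← h2]⟩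
  · obtain ⟨a, b, a', b', h1, h2⟩ := key1 x z y (by omega)
    exact ⟨a, b, a', b', h1, by rw [← h2]; ext q; simp; tauto⟩
  · obtain ⟨a, b, a', b', h1, h2⟩ := key2 y z x (by omega)
    exact ⟨a, b, a', b', h1, by rw [← h2]; ext q; simp; tauto⟩
  · obtain ⟨a, b, a', b', h1, h2⟩ := key1 y z x (by omega)
    exact ⟨a, b, a', b', h1, by rw [← h2]; ext q; simp; tauto⟩
  · obtain ⟨a, b, a', b', h1, h2⟩ := key2 x z y (by omega)
    exact ⟨a, b, a', b', h1, by rw [← h2]; ext q; simp; tauto⟩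
  · obtain ⟨a, b, a', b', h1, h2⟩ := key2 x y z (by omega)
    exact ⟨a, b, a', b', h1, by rw [← h2]⟩
  · omega

/-- The lines through the left and the right slanted side bound the triangle. At height $1/2$ they
cut out an interval of length $1/2$, which becomes a unit interval with integer ends once abscissas
are doubled. -/
theorem IsStep.mem_hull_bounds {a : Fin (k + 1)} {b : Fin (l + 1)} {a' : Fin (k + 1)}
    {b' : Fin (l + 1)} (h : IsStep a b a' b') {x : ℝ}
    (hx : (x / 2, (1 / 2 : ℝ)) ∈
      hull ({Sum.inl a, Sum.inr b, Sum.inl a', Sum.inr b'} : Finset (Vertex k l))) :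
    ((a : ℕ) : ℝ) + (b : ℕ) ≤ x ∧ x ≤ ((a : ℕ) : ℝ) + (b : ℕ) + 1 := by
  have h' : (((a' : ℕ) : ℝ) = (a : ℕ) + 1 ∧ ((b' : ℕ) : ℝ) = (b : ℕ)) ∨
      (((a' : ℕ) : ℝ) = (a : ℕ) ∧ ((b' : ℕ) : ℝ) = (b : ℕ) + 1) := by
    rcases h with ⟨h1, h2⟩ | ⟨h1, h2⟩
    · left; rw [h1, h2]; simp
    · right; rw [h1, h2]; simp
  have h1 := hull_subset_halfPlane (α := -1) (β := (b : ℕ) - (a : ℕ)) (c := -(a : ℕ)) (by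
    intro v hv
    simp only [Finset.mem_insert, Finset.mem_singleton] at hv
    rcases hv with rfl | rfl | rfl | rfl <;> simp only [toPlane_inl, toPlane_inr] <;>
      rcases h' with ⟨h1, h2⟩ | ⟨h1, h2⟩ <;> linarith) hx
  have h2 := hull_subset_halfPlane (α := 1) (β := (a' : ℕ) - (b' : ℕ)) (c := (a' : ℕ)) (by
    intro v hv
    simp only [Finset.mem_insert, Finset.mem_singleton] at hv
    rcases hv with rfl | rfl | rfl | rfl <;> simp only [toPlane_inl, toPlane_inr] <;>
      rcases h' with ⟨h1, h2⟩ | ⟨h1, h2⟩ <;> linarith) hx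
  simp only [mem_ofPred_eq] at h1 h2
  rcases h' with ⟨h3, h4⟩ | ⟨h3, h4⟩ <;> rw [h3, h4] at h2 <;> constructor <;> linarith

/-- The segment between the midpoints of the two slanted sides runs at height $1/2$ from abscissa
$0$ to $(k+l)/2$. -/
theorem midpoint_mem_trapezoid {x : ℝ} (h0 : 0 ≤ x) (h1 : x ≤ k + l) (hkl : 0 < k + l) :
    (x / 2, (1 / 2 : ℝ)) ∈ trapezoid k l := by
  have hpos : (0 : ℝ) < k + l := by exact_mod_cast hkl
  have hc : Convex ℝ (trapezoid k l) := convex_convexHull _ _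
  have m1 : ((0 : ℝ), (0 : ℝ)) ∈ trapezoid k l := subset_convexHull _ _ (by simp)
  have m2 : ((0 : ℝ), (1 : ℝ)) ∈ trapezoid k l := subset_convexHull _ _ (by simp)
  have m3 : ((k : ℝ), (0 : ℝ)) ∈ trapezoid k l := subset_convexHull _ _ (by simp)
  have m4 : ((l : ℝ), (1 : ℝ)) ∈ trapezoid k l := subset_convexHull _ _ (by simp)
  have n1 := hc m1 m2 (a := 1 / 2) (b := 1 / 2) (by norm_num) (by norm_num) (by norm_num)
  have n2 := hc m3 m4 (a := 1 / 2) (b := 1 / 2) (by norm_num) (by norm_num) (by norm_num)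
  have n3 := hc n1 n2 (a := 1 - x / (k + l)) (b := x / (k + l))
    (by rw [sub_nonneg, div_le_one hpos]; exact h1) (by positivity) (by ring)
  convert n3 using 1
  ext
  · simp; field_simp
  · simp; field_simp; ring

theorem midpoint_mem_hull {t : Finset (Vertex k l)} {a : Fin (k + 1)} {b : Fin (l + 1)}
    (ha : Sum.inl a ∈ t) (hb : Sum.inr b ∈ t) :
    ((((a : ℕ) : ℝ) + (b : ℕ)) / 2, (1 / 2 : ℝ)) ∈ hull t := by
  have hc : Convex ℝ (hull t) := convex_convexHull _ _
  have m1 : Vertex.toPlane (Sum.inl a) ∈ hull t := subset_convexHull _ _ ⟨_, ha, rfl⟩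
  have m2 : Vertex.toPlane (Sum.inr b) ∈ hull t := subset_convexHull _ _ ⟨_, hb, rfl⟩
  have n1 := hc m1 m2 (a := 1 / 2) (b := 1 / 2) (by norm_num) (by norm_num) (by norm_num)
  convert n1 using 1
  ext
  · simp; ring
  · simp

/-- A hull with all its vertices on one horizontal side cannot reach height $1/2$. -/
theorem exists_inl_inr_mem_of_mem_hull {t : Finset (Vertex k l)} {x : ℝ}
    (hx : (x, (1 / 2 : ℝ)) ∈ hull t) :
    (∃ a, Sum.inl a ∈ t) ∧ ∃ b, Sum.inr b ∈ t := by
  constructor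
  · by_contra! h
    have := hull_subset_halfPlane (α := 0) (β := -1) (c := -1) (by
      rintro (v | v) hv
      · exact absurd hv (h v)
      · simp) hx
    norm_num at this
  · by_contra! h
    have := hull_subset_halfPlane (α := 0) (β := 1) (c := 0) (by
      rintro (v | v) hv
      · simp
      · exact absurd hv (h v)) hx
    norm_num at this

/-- The triangles form a strip: they are ordered from left to right. -/
theorem MaximalTriangulation.exists_strip (T : MaximalTriangulation k l) (hkl : 0 < k + l) :
    ∃ (A : ℕ → Fin (k + 1)) (B : ℕ → Fin (l + 1)),
      (∀ n ≤ k + l, (A n : ℕ) + B n = n) ∧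
      ∀ n < k + l, IsStep (A n) (B n) (A (n + 1)) (B (n + 1)) ∧
        {Sum.inl (A n), Sum.inr (B n), Sum.inl (A (n + 1)), Sum.inr (B (n + 1))} ∈ T.triangles := by
  have h1 : ∀ n : ℕ, ∃ a b a' b', n < k + l →
      IsStep a b a' b' ∧ {Sum.inl a, Sum.inr b, Sum.inl a', Sum.inr b'} ∈ T.triangles ∧
        (a : ℕ) + b = n := by
    intro n
    by_cases hn : n < k + l
    · have hn' : (n : ℝ) + 1 ≤ k + l := by exact_mod_cast hn
      -- The doubled abscissa $n+1/2$ is interior to the unit interval $[n,n+1]$, so a triangle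
      -- containing this point has left side with $a+b=n$ exactly.
      have := midpoint_mem_trapezoid (k := k) (l := l) (x := n + 1 / 2) (by positivity)
        (by linarith) hkl
      rw [← T.cover] at this
      simp only [mem_iUnion] at this
      obtain ⟨t, ht, hx⟩ := this
      obtain ⟨a, b, a', b', hs, rfl⟩ := (T.standard t ht).exists_isStep
      refine ⟨a, b, a', b', fun _ => ⟨hs, ht, ?_⟩⟩
      obtain ⟨h1, h2⟩ := hs.mem_hull_bounds hx
      have h3 : ((a : ℕ) : ℝ) + (b : ℕ) < (n : ℝ) + 1 := by linarith
      have h4 : (n : ℝ) < ((a : ℕ) : ℝ) + (b : ℕ) + 1 := by linarith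
      norm_cast at h3 h4
      omega
    · exact ⟨0, 0, 0, 0, fun h => absurd h hn⟩
  choose A B A' B' h using h1
  have hsum : ∀ n < k + l, (A' n : ℕ) + B' n = n + 1 := by
    intro n hn
    obtain ⟨hs | hs, -, h3⟩ := h n hn
    · have := congrArg Fin.val hs.2; omega
    · have := congrArg Fin.val hs.1; omega
  have glue : ∀ n, n + 1 < k + l → A (n + 1) = A' n ∧ B (n + 1) = B' n := by
    intro n hn
    obtain ⟨s1, t1, e1⟩ := h n (by omega)
    obtain ⟨s2, t2, e2⟩ := h (n + 1) hn
    have e1' := hsum n (by omega)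
    have hx : (((n : ℝ) + 1) / 2, (1 / 2 : ℝ)) ∈ hull (k := k) (l := l)
        ({Sum.inl (A n), Sum.inr (B n), Sum.inl (A' n), Sum.inr (B' n)} ∩
        {Sum.inl (A (n + 1)), Sum.inr (B (n + 1)), Sum.inl (A' (n + 1)), Sum.inr (B' (n + 1))}) := by
      rw [← T.face_to_face _ t1 _ t2]
      constructor
      · have := midpoint_mem_hull (t := ({Sum.inl (A n), Sum.inr (B n), Sum.inl (A' n),
          Sum.inr (B' n)} : Finset (Vertex k l))) (a := A' n) (b := B' n) (by simp) (by simp)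
        convert this using 3
        exact_mod_cast e1'.symm
      · have := midpoint_mem_hull (t := ({Sum.inl (A (n + 1)), Sum.inr (B (n + 1)),
          Sum.inl (A' (n + 1)), Sum.inr (B' (n + 1))} : Finset (Vertex k l)))
          (a := A (n + 1)) (b := B (n + 1)) (by simp) (by simp)
        convert this using 3
        exact_mod_cast e2.symm
    obtain ⟨⟨a, ha⟩, ⟨b, hb⟩⟩ := exists_inl_inr_mem_of_mem_hull hx
    simp only [Finset.mem_inter, Finset.mem_insert, Finset.mem_singleton, Sum.inl.injEq,
      Sum.inr.injEq, reduceCtorEq, false_or, or_false] at ha hb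
    -- The common vertices $a,b$ are at most those of the right side of triangle $n$, whose sum is
    -- $n+1$, and at least those of the left side of triangle $n+1$, whose sum is also $n+1$. All
    -- these inequalities are therefore equalities.
    unfold IsStep at s1 s2
    simp only [Fin.ext_iff] at *
    omega
  -- `A` and `B` are meaningful only as left sides of triangles. Index $k+l$ must give the right
  -- side of the last triangle, which is $(k,l)$ because its coordinates sum to $k+l$.
  refine ⟨fun n => if n < k + l then A n else Fin.last k,
    fun n => if n < k + l then B n else Fin.last l, ?_, ?_⟩
  · intro n hn
    by_cases hn' : n < k + l
    · simp only [hn', if_true]; exact (h n hn').2.2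
    · simp only [hn', if_false, Fin.val_last]; omega
  · intro n hn
    have e : (if n + 1 < k + l then A (n + 1) else Fin.last k) = A' n ∧
        (if n + 1 < k + l then B (n + 1) else Fin.last l) = B' n := by
      by_cases hn' : n + 1 < k + l
      · simp only [hn', if_true]; exact glue n hn'
      · have := hsum n hn
        simp only [hn', if_false, Fin.ext_iff, Fin.val_last]
        omega
    simp only [hn, if_true, e.1, e.2]
    exact ⟨(h n hn).1, (h n hn).2.1⟩

/-! ### Combinatorics of the fan -/

namespace IsMaxCone

variable {T : MaximalTriangulation k l} {σ : Finset (Ray k l)}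

/-- These are the possible ways in which $(1,0,0)$ is a combination of the generators of the cone:
up to sign a generator, or a difference of two horizontal neighbours. -/
theorem mem_cases (hσ : IsMaxCone T σ) :
    Ray.xiInf ∈ σ ∨ Ray.xiZero ∈ σ ∨
      (∃ i : Fin k, Ray.bot i.castSucc ∈ σ ∧ Ray.bot i.succ ∈ σ) ∨
      ∃ j : Fin l, Ray.top j.castSucc ∈ σ ∧ Ray.top j.succ ∈ σ := by
  cases hσ with
  | triangle t ht =>
    obtain ⟨a, b, a', b', ⟨h1, h2⟩ | ⟨h1, h2⟩, rfl⟩ := (T.standard t ht).exists_isStep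
    · have := a'.2
      refine Or.inr (Or.inr (Or.inl ⟨⟨a, by omega⟩, ?_, ?_⟩))
      · simp
      · simp [Fin.ext_iff, h1]
    · have := b'.2
      refine Or.inr (Or.inr (Or.inr ⟨⟨b, by omega⟩, ?_, ?_⟩))
      · simp
      · simp [Fin.ext_iff, h2]
  | botEdge i => exact Or.inr (Or.inr (Or.inl ⟨i, by simp⟩))
  | topEdge i => exact Or.inr (Or.inr (Or.inr ⟨i, by simp⟩))
  | _ => simp

/-- This decides the form of $z$ in the chart: the reciprocal of one coordinate, one coordinate, or
a product of two. In the last case the common zero set of the two factors is a fixed curve. -/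
theorem bot_cases (hσ : IsMaxCone T σ) :
    (Ray.zInf ∈ σ ∧ ∀ i, Ray.bot i ∉ σ) ∨
      (Ray.zInf ∉ σ ∧ ∃ i, Ray.bot i ∈ σ ∧ ∀ i', i' ≠ i → Ray.bot i' ∉ σ) ∨
      (Ray.zInf ∉ σ ∧ ∃ i : Fin k, Ray.bot i.castSucc ∈ σ ∧ Ray.bot i.succ ∈ σ ∧
        ∀ i', i' ≠ i.castSucc → i' ≠ i.succ → Ray.bot i' ∉ σ) := by
  cases hσ with
  | triangle t ht =>
    obtain ⟨a, b, a', b', ⟨h1, h2⟩ | ⟨h1, h2⟩, rfl⟩ := (T.standard t ht).exists_isStep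
    · have := a'.2
      refine Or.inr (Or.inr ⟨by simp, ⟨a, by omega⟩, ?_, ?_, ?_⟩)
      · simp
      · simp [Fin.ext_iff, h1]
      · simp [Fin.ext_iff, h1]; tauto
    · exact Or.inr (Or.inl ⟨by simp, a, by simp, by simp [h1]⟩)
  | botEdge i => exact Or.inr (Or.inr ⟨by simp, i, by simp, by simp, by simp; tauto⟩)
  | left => exact Or.inr (Or.inl ⟨by simp, 0, by simp, by simp⟩)
  | right => exact Or.inr (Or.inl ⟨by simp, Fin.last k, by simp, by simp⟩)
  | botLeft => exact Or.inr (Or.inl ⟨by simp, 0, by simp, by simp⟩)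
  | botRight => exact Or.inr (Or.inl ⟨by simp, Fin.last k, by simp, by simp⟩)
  | _ => exact Or.inl (by simp)

theorem top_cases (hσ : IsMaxCone T σ) :
    (Ray.wInf ∈ σ ∧ ∀ j, Ray.top j ∉ σ) ∨
      (Ray.wInf ∉ σ ∧ ∃ j, Ray.top j ∈ σ ∧ ∀ j', j' ≠ j → Ray.top j' ∉ σ) ∨
      (Ray.wInf ∉ σ ∧ ∃ j : Fin l, Ray.top j.castSucc ∈ σ ∧ Ray.top j.succ ∈ σ ∧
        ∀ j', j' ≠ j.castSucc → j' ≠ j.succ → Ray.top j' ∉ σ) := by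
  cases hσ with
  | triangle t ht =>
    obtain ⟨a, b, a', b', ⟨h1, h2⟩ | ⟨h1, h2⟩, rfl⟩ := (T.standard t ht).exists_isStep
    · exact Or.inr (Or.inl ⟨by simp, b, by simp, by simp [h2]⟩)
    · have := b'.2
      refine Or.inr (Or.inr ⟨by simp, ⟨b, by omega⟩, ?_, ?_, ?_⟩)
      · simp
      · simp [Fin.ext_iff, h2]
      · simp [Fin.ext_iff, h2]; tauto
  | topEdge i => exact Or.inr (Or.inr ⟨by simp, i, by simp, by simp, by simp; tauto⟩)
  | left => exact Or.inr (Or.inl ⟨by simp, 0, by simp, by simp⟩)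
  | right => exact Or.inr (Or.inl ⟨by simp, Fin.last l, by simp, by simp⟩)
  | topLeft => exact Or.inr (Or.inl ⟨by simp, 0, by simp, by simp⟩)
  | topRight => exact Or.inr (Or.inl ⟨by simp, Fin.last l, by simp, by simp⟩)
  | _ => exact Or.inl (by simp)

end IsMaxCone

/-! ### Charts of the toric variety -/

section Charts

variable {T : MaximalTriangulation k l}

/-- The homogeneous coordinates of a point of an affine chart. -/
def homog (σ : MaxCone T) (x : ChartSpace σ) (ρ : Ray k l) : ℂ :=
  if h : ρ ∈ σ.1 then x ⟨ρ, h⟩ else 1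

theorem homog_of_mem (σ : MaxCone T) (x : ChartSpace σ) {ρ : Ray k l} (h : ρ ∈ σ.1) :
    homog σ x ρ = x ⟨ρ, h⟩ := dif_pos h

theorem homog_of_notMem (σ : MaxCone T) (x : ChartSpace σ) {ρ : Ray k l} (h : ρ ∉ σ.1) :
    homog σ x ρ = 1 := dif_neg h

theorem mem_of_homog_eq_zero {σ : MaxCone T} {x : ChartSpace σ} {ρ : Ray k l}
    (h : homog σ x ρ = 0) : ρ ∈ σ.1 := by
  by_contra h'
  rw [homog_of_notMem σ x h'] at h
  exact one_ne_zero h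

theorem chart_eq_toPoint (σ : MaxCone T) (x : ChartSpace σ) :
    chart σ x = toPoint ⟨homog σ x, σ, fun _ => mem_of_homog_eq_zero⟩ := rfl

theorem chart_eq_chart_of_homog_eq {σ τ : MaxCone T} {x : ChartSpace σ} {y : ChartSpace τ}
    (h : homog σ x = homog τ y) : chart σ x = chart τ y := by
  simp only [chart_eq_toPoint, h]

theorem toPoint_eq_of_smul {u v : HomogCoord T} {g : Ray k l → ℂˣ} (hg : g ∈ coxGroup k l)
    (h : ∀ ρ, v.1 ρ = (g ρ : ℂ) * u.1 ρ) : toPoint u = toPoint v :=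
  Quotient.sound ⟨g, hg, h⟩

theorem prod_zpow_eq_zpow_sum {ι G : Type*} [CommGroup G] (s : Finset ι) (c : G) (f : ι → ℤ) :
    ∏ i ∈ s, c ^ f i = c ^ ∑ i ∈ s, f i := by
  classical
  induction s using Finset.induction_on with
  | empty => simp
  | insert i s hi ih => rw [Finset.prod_insert hi, Finset.sum_insert hi, ih, zpow_add]

/-- Integral relations between the ray generators give one-parameter subgroups of the group; all
changes of homogeneous coordinates below arise in this way. -/
theorem zpow_mem_coxGroup {b : Ray k l → ℤ} (hb : ∑ ρ, b ρ • ρ.gen = 0) (c : ℂˣ) :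
    (fun ρ => c ^ b ρ) ∈ coxGroup k l := by
  intro m
  simp only [← zpow_mul]
  rw [prod_zpow_eq_zpow_sum]
  have : ∑ ρ : Ray k l, b ρ * Ray.pairing m ρ = 0 := by
    simp only [Ray.pairing, Finset.mul_sum]
    rw [Finset.sum_comm]
    refine Finset.sum_eq_zero fun i _ => ?_
    have h := congrFun hb i
    simp only [Finset.sum_apply, Pi.smul_apply, smul_eq_mul, Pi.zero_apply] at h
    calc ∑ ρ : Ray k l, b ρ * (m i * ρ.gen i) = m i * ∑ ρ : Ray k l, b ρ * ρ.gen i := by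
          rw [Finset.mul_sum]; exact Finset.sum_congr rfl fun _ _ => by ring
      _ = 0 := by rw [h, mul_zero]
  rw [this, zpow_zero]

/-! ### Lattice vectors in the basis of a maximal cone, and the weights of the circle action -/

/-- `a` expresses the lattice vector `v` by the generators of the cone `σ`. -/
structure IsCoeff (σ : MaxCone T) (v : Fin 3 → ℤ) (a : Ray k l → ℤ) : Prop where
  eq_zero : ∀ ρ, ρ ∉ σ.1 → a ρ = 0
  sum_eq : ∑ ρ, a ρ • ρ.gen = v

theorem sum_single_smul_gen (ρ : Ray k l) (n : ℤ) :
    ∑ ρ', (Pi.single ρ n : Ray k l → ℤ) ρ' • ρ'.gen = n • ρ.gen := by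
  rw [Finset.sum_eq_single ρ]
  · simp
  · intro b _ hb
    simp [hb]
  · simp

theorem IsCoeff.add {σ : MaxCone T} {v w : Fin 3 → ℤ} {a b : Ray k l → ℤ} (ha : IsCoeff σ v a)
    (hb : IsCoeff σ w b) : IsCoeff σ (v + w) (a + b) where
  eq_zero ρ h := by simp [ha.eq_zero ρ h, hb.eq_zero ρ h]
  sum_eq := by simp only [Pi.add_apply, add_smul, Finset.sum_add_distrib, ha.sum_eq, hb.sum_eq]

theorem IsCoeff.smul {σ : MaxCone T} {v : Fin 3 → ℤ} {a : Ray k l → ℤ} (ha : IsCoeff σ v a)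
    (n : ℤ) : IsCoeff σ (n • v) (n • a) where
  eq_zero ρ h := by simp [ha.eq_zero ρ h]
  sum_eq := by simp only [Pi.smul_apply, smul_assoc, ← Finset.smul_sum, ha.sum_eq]

theorem isCoeff_single {σ : MaxCone T} {ρ : Ray k l} (h : ρ ∈ σ.1) :
    IsCoeff σ ρ.gen (Pi.single ρ 1) where
  eq_zero ρ' h' := Pi.single_eq_of_ne (fun e => h' (by rwa [e])) _
  sum_eq := by rw [sum_single_smul_gen, one_smul]

theorem isCoeff_of_xiZero_mem {σ : MaxCone T} (h : Ray.xiZero ∈ σ.1) :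
    IsCoeff σ ![1, 0, 0] (Pi.single Ray.xiZero 1) := isCoeff_single h

theorem isCoeff_of_xiInf_mem {σ : MaxCone T} (h : Ray.xiInf ∈ σ.1) :
    IsCoeff σ ![1, 0, 0] (-1 • Pi.single Ray.xiInf 1) := by
  convert (isCoeff_single h).smul (-1) using 1
  ext i; fin_cases i <;> simp [Ray.gen]

theorem isCoeff_of_bot_mem {σ : MaxCone T} {i i' : Fin (k + 1)} (hi : (i' : ℕ) = i + 1)
    (h : Ray.bot i ∈ σ.1) (h' : Ray.bot i' ∈ σ.1) :
    IsCoeff σ ![1, 0, 0] (Pi.single (Ray.bot i') 1 + -1 • Pi.single (Ray.bot i) 1) := by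
  convert (isCoeff_single h').add ((isCoeff_single h).smul (-1)) using 1
  ext i; fin_cases i <;> simp [Ray.gen, Vertex.coord, hi]

theorem isCoeff_of_top_mem {σ : MaxCone T} {j j' : Fin (l + 1)} (hj : (j' : ℕ) = j + 1)
    (h : Ray.top j ∈ σ.1) (h' : Ray.top j' ∈ σ.1) :
    IsCoeff σ ![1, 0, 0] (Pi.single (Ray.top j') 1 + -1 • Pi.single (Ray.top j) 1) := by
  convert (isCoeff_single h').add ((isCoeff_single h).smul (-1)) using 1
  ext i; fin_cases i <;> simp [Ray.gen, Vertex.coord, hj]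

theorem exists_isCoeff_circle (σ : MaxCone T) : ∃ a, IsCoeff σ ![1, 0, 0] a := by
  rcases σ.2.mem_cases with h | h | ⟨i, h, h'⟩ | ⟨j, h, h'⟩
  · exact ⟨_, isCoeff_of_xiInf_mem h⟩
  · exact ⟨_, isCoeff_of_xiZero_mem h⟩
  · exact ⟨_, isCoeff_of_bot_mem (by simp) h h'⟩
  · exact ⟨_, isCoeff_of_top_mem (by simp) h h'⟩

/-- The generators of a maximal cone span the lattice. -/
theorem exists_isCoeff (σ : MaxCone T) (v : Fin 3 → ℤ) : ∃ a, IsCoeff σ v a := by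
  -- Modulo $(1,0,0)$ the lattice is spanned by $(0,1)$ and $(1,1)$, up to sign the generators of
  -- the fan of $\mathbb P^1\times\mathbb P^1$; each of them lifts to a combination of generators of
  -- the cone.
  obtain ⟨a, ha⟩ := exists_isCoeff_circle σ
  have hb : ∃ b n, IsCoeff σ ![n, 0, 1] b := by
    have h1 : Ray.zInf ∈ σ.1 ∨ ∃ i, Ray.bot i ∈ σ.1 := by
      rcases σ.2.bot_cases with h | ⟨-, i, h, -⟩ | ⟨-, i, h, -⟩
      exacts [Or.inl h.1, Or.inr ⟨i, h⟩, Or.inr ⟨_, h⟩]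
    rcases h1 with h | ⟨i, h⟩
    · refine ⟨-1 • Pi.single Ray.zInf 1, 0, ?_⟩
      convert (isCoeff_single h).smul (-1) using 1
      ext i; fin_cases i <;> simp [Ray.gen]
    · exact ⟨_, (i : ℕ), isCoeff_single h⟩
  have hc : ∃ c n, IsCoeff σ ![n, 1, 1] c := by
    have h1 : Ray.wInf ∈ σ.1 ∨ ∃ i, Ray.top i ∈ σ.1 := by
      rcases σ.2.top_cases with h | ⟨-, i, h, -⟩ | ⟨-, i, h, -⟩
      exacts [Or.inl h.1, Or.inr ⟨i, h⟩, Or.inr ⟨_, h⟩]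
    rcases h1 with h | ⟨i, h⟩
    · refine ⟨-1 • Pi.single Ray.wInf 1, 0, ?_⟩
      convert (isCoeff_single h).smul (-1) using 1
      ext i; fin_cases i <;> simp [Ray.gen]
    · exact ⟨_, (i : ℕ), isCoeff_single h⟩
  obtain ⟨b, n, hb⟩ := hb
  obtain ⟨c, p, hc⟩ := hc
  have key := ((hc.smul (v 1)).add (hb.smul (v 2 - v 1))).add
    (ha.smul (v 0 - v 1 * p - (v 2 - v 1) * n))
  have hv : v 1 • ![p, 1, 1] + (v 2 - v 1) • ![n, 0, 1] +
      (v 0 - v 1 * p - (v 2 - v 1) * n) • ![1, 0, 0] = v := by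
    ext i; fin_cases i <;> simp
  rw [hv] at key
  exact ⟨_, key⟩

/-- Each chart parametrizes all points whose vanishing homogeneous coordinates belong to its
cone. -/
theorem exists_chart_eq_toPoint (σ : MaxCone T) (u : HomogCoord T)
    (hu : ∀ ρ, u.1 ρ = 0 → ρ ∈ σ.1) :
    ∃ x : ChartSpace σ, chart σ x = toPoint u ∧ ∀ ρ (h : ρ ∈ σ.1), x ⟨ρ, h⟩ = 0 ↔ u.1 ρ = 0 := by
  choose A hA using fun ρ : Ray k l => exists_isCoeff σ ρ.gen
  let U : Ray k l → ℂˣ := fun ρ => if h : u.1 ρ = 0 then 1 else Units.mk0 _ h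
  -- Each $\rho'$ outside the cone satisfies the relation that its generator minus its expansion in
  -- the cone is $0$. The subgroup of this relation scales the coordinate of $\rho'$ to $1$ and
  -- leaves the other coordinates outside the cone alone.
  let g : Ray k l → ℂˣ := ∏ ρ' ∈ σ.1ᶜ,
    fun ρ => U ρ' ^ (A ρ' ρ + (Pi.single ρ' (-1) : Ray k l → ℤ) ρ)
  have hg : g ∈ coxGroup k l := by
    refine Subgroup.prod_mem _ fun ρ' _ => zpow_mem_coxGroup ?_ _
    simp only [add_smul, Finset.sum_add_distrib, (hA ρ').sum_eq, sum_single_smul_gen]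
    simp
  have hg1 : ∀ ρ, ρ ∉ σ.1 → (g ρ : ℂ) * u.1 ρ = 1 := by
    intro ρ hρ
    have h1 : g ρ = (U ρ)⁻¹ := by
      simp only [g, Finset.prod_apply]
      rw [Finset.prod_eq_single ρ]
      · simp [(hA ρ).eq_zero ρ hρ]
      · intro b _ hb
        simp [(hA b).eq_zero ρ hρ, Pi.single_eq_of_ne hb.symm]
      · simp [hρ]
    have h2 : u.1 ρ ≠ 0 := fun h => hρ (hu ρ h)
    simp [h1, U, h2]
  refine ⟨fun ρ => (g ρ : ℂ) * u.1 ρ, ?_, ?_⟩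
  · rw [chart_eq_toPoint]
    symm
    refine toPoint_eq_of_smul hg fun ρ => ?_
    by_cases h : ρ ∈ σ.1
    · exact homog_of_mem σ (fun ρ => (g ρ : ℂ) * u.1 ρ) h
    · exact (homog_of_notMem σ (fun ρ => (g ρ : ℂ) * u.1 ρ) h).trans (hg1 ρ h).symm
  · intro ρ h
    simp

theorem exists_toPoint_eq (p : ToricVariety T) : ∃ u : HomogCoord T, toPoint u = p :=
  Quotient.exists_rep p

theorem exists_chart_eq (p : ToricVariety T) :
    ∃ (σ : MaxCone T) (x : ChartSpace σ), chart σ x = p := by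
  obtain ⟨u, rfl⟩ := exists_toPoint_eq p
  obtain ⟨σ, hσ⟩ := u.2
  obtain ⟨x, hx, -⟩ := exists_chart_eq_toPoint σ u hσ
  exact ⟨σ, x, hx⟩

/-- A point of the intersection of two toric divisors lies in a chart of a cone containing both
rays. -/
theorem exists_chart_eq_of_mem_toricDivisor {p : ToricVariety T} {ρ ρ' : Ray k l}
    (h : p ∈ toricDivisor T ρ) (h' : p ∈ toricDivisor T ρ') :
    ∃ (σ : MaxCone T) (x : ChartSpace σ), chart σ x = p ∧ homog σ x ρ = 0 ∧ homog σ x ρ' = 0 := by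
  obtain ⟨u, rfl, hu⟩ := h
  obtain ⟨u', he, hu'⟩ := h'
  obtain ⟨g, -, hg⟩ : coxSetoid T u' u := Quotient.exact he
  have hu'' : u.1 ρ' = 0 := by rw [hg, hu', mul_zero]
  obtain ⟨σ, hσ⟩ := u.2
  obtain ⟨x, hx, hx'⟩ := exists_chart_eq_toPoint σ u hσ
  refine ⟨σ, x, hx, ?_, ?_⟩
  · rw [homog_of_mem σ x (hσ _ hu)]; exact (hx' _ _).2 hu
  · rw [homog_of_mem σ x (hσ _ hu'')]; exact (hx' _ _).2 hu''

/-- The action of the one-parameter subgroup of `(1,0,0)` in a chart is linear, with weights the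
coefficients of `(1,0,0)`. -/
theorem chart_zpow_mul_eq_toPoint {σ : MaxCone T} {a : Ray k l → ℤ} (ha : IsCoeff σ ![1, 0, 0] a)
    (c : ℂˣ) (x : ChartSpace σ) :
    chart σ (fun ρ => (c : ℂ) ^ a ρ * x ρ) =
      toPoint ⟨fun ρ => ((Function.update 1 Ray.xiZero c : Ray k l → ℂˣ) ρ : ℂ) * homog σ x ρ, σ,
        fun _ h => mem_of_homog_eq_zero ((mul_eq_zero.1 h).resolve_left (Units.ne_zero _))⟩ := by
  symm
  -- The relation used is the expansion of $(1,0,0)$ in the cone minus the generator of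
  -- `Ray.xiZero`; it trades the factor on that one coordinate for the weights on the chart.
  refine toPoint_eq_of_smul (g := fun ρ => c ^ (a ρ + (Pi.single Ray.xiZero (-1) : Ray k l → ℤ) ρ))
    (zpow_mem_coxGroup ?_ _) fun ρ => ?_
  · simp only [add_smul, Finset.sum_add_distrib, ha.sum_eq, sum_single_smul_gen]
    ext i; fin_cases i <;> simp [Ray.gen]
  · change homog σ (fun ρ => (c : ℂ) ^ a ρ * x ρ) ρ = _
    have hc : (c : ℂ) ≠ 0 := c.ne_zero
    have e : (c : ℂ) ^ a ρ * homog σ x ρ = homog σ (fun ρ => (c : ℂ) ^ a ρ * x ρ) ρ := by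
      by_cases h : ρ ∈ σ.1
      · simp only [homog_of_mem σ _ h]
      · simp [homog_of_notMem σ _ h, ha.eq_zero ρ h]
    rw [← e]
    by_cases h : ρ = Ray.xiZero
    · subst h
      simp [zpow_add₀ hc]
      field_simp
    · simp [h]

theorem chart_zpow_mul {σ : MaxCone T} {a : Ray k l → ℤ} (ha : IsCoeff σ ![1, 0, 0] a) (c : Circle)
    (x : ChartSpace σ) :
    chart σ (fun ρ => (c : ℂ) ^ a ρ * x ρ) = circleAct c (chart σ x) := by
  refine (chart_zpow_mul_eq_toPoint ha (Circle.toUnits c) x).trans ?_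
  change _ = toPoint ⟨fun ρ => ((Function.update 1 Ray.xiZero c : Ray k l → Circle) ρ : ℂ) *
    homog σ x ρ, _⟩
  congr 2
  funext ρ
  by_cases h : ρ = Ray.xiZero
  · subst h; simp
  · simp [h]

theorem isFundamentalVector {σ : MaxCone T} {a : Ray k l → ℤ} (ha : IsCoeff σ ![1, 0, 0] a)
    (x : ChartSpace σ) :
    IsFundamentalVector σ x (fun ρ => Complex.I * a ρ * x ρ) := by
  refine ⟨fun θ ρ => ((Circle.exp θ : Circle) : ℂ) ^ a ρ * x ρ, ?_, ?_, fun θ => ?_⟩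
  · ext ρ; simp
  · rw [hasDerivAt_pi]
    intro ρ
    have h1 : HasDerivAt (fun θ : ℝ => Complex.exp ((θ : ℂ) * (a ρ * Complex.I)))
        (1 * (a ρ * Complex.I)) 0 := by
      have h2 : HasDerivAt (fun θ : ℝ => (θ : ℂ) * (a ρ * Complex.I)) (1 * (a ρ * Complex.I)) 0 :=
        (Complex.ofRealCLM.hasDerivAt (x := (0 : ℝ))).mul_const _
      simpa using h2.cexp
    have h3 : (fun θ : ℝ => ((Circle.exp θ : Circle) : ℂ) ^ a ρ * x ρ) =
        fun θ : ℝ => Complex.exp ((θ : ℂ) * (a ρ * Complex.I)) * x ρ := by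
      funext θ
      rw [Circle.coe_exp, ← Complex.exp_int_mul]
      congr 2
      ring
    rw [h3, show Complex.I * a ρ * x ρ = 1 * (a ρ * Complex.I) * x ρ by ring]
    exact h1.mul_const (x ρ)
  · exact chart_zpow_mul ha _ x

end Charts

/-! ### The moment map of the circle action -/

section Moment

variable {T : MaximalTriangulation k l} {ω : ToricKahlerForm T} {μ : ToricVariety T → ℝ}

/-- This moves a reference point between charts: if its coordinates are $1$ outside both cones, both
charts give it the same homogeneous coordinates. -/
theorem chart_restrict_eq {σ τ : MaxCone T} {u : Ray k l → ℂ} (hσ : ∀ ρ, ρ ∉ σ.1 → u ρ = 1)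
    (hτ : ∀ ρ, ρ ∉ τ.1 → u ρ = 1) : chart σ (fun ρ => u ρ) = chart τ (fun ρ => u ρ) := by
  apply chart_eq_chart_of_homog_eq
  funext ρ
  have h : ∀ σ : MaxCone T, (∀ ρ, ρ ∉ σ.1 → u ρ = 1) → homog σ (fun ρ => u ρ) ρ = u ρ := by
    intro σ hσ
    by_cases h : ρ ∈ σ.1
    · rw [homog_of_mem σ _ h]
    · rw [homog_of_notMem σ _ h, hσ ρ h]
  rw [h σ hσ, h τ hτ]

/-- The fundamental vector field of the flow complementary to the circle action, that is, of the
action of the positive real numbers. -/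
def flowVector (σ : MaxCone T) (a : Ray k l → ℤ) (x : ChartSpace σ) : ChartSpace σ :=
  fun ρ => a ρ * x ρ

namespace IsCircleMomentMap

theorem differentiable_chart (hμ : IsCircleMomentMap ω μ) (σ : MaxCone T) :
    Differentiable ℝ (fun x => μ (chart σ x)) :=
  (hμ.smooth σ).differentiable (by simp)

theorem continuous_chart (hμ : IsCircleMomentMap ω μ) (σ : MaxCone T) :
    Continuous (fun x => μ (chart σ x)) := (hμ.smooth σ).continuous

/-- The fundamental vector is $i$ times `flowVector`, so the Hamiltonian equation makes `flowVector`
the gradient of $\mu$ for the metric $\omega(\cdot,i\,\cdot)$. -/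
theorem fderiv_eq (hμ : IsCircleMomentMap ω μ) {σ : MaxCone T} {a : Ray k l → ℤ}
    (ha : IsCoeff σ ![1, 0, 0] a) (x v : ChartSpace σ) :
    fderiv ℝ (fun y => μ (chart σ y)) x v = ω.form σ x ![v, Complex.I • flowVector σ a x] := by
  rw [hμ.hamiltonian σ x _ (isFundamentalVector ha x) v]
  congr 3
  funext ρ
  simp [flowVector, mul_assoc]

theorem fderiv_flowVector_pos (hμ : IsCircleMomentMap ω μ) {σ : MaxCone T} {a : Ray k l → ℤ}
    (ha : IsCoeff σ ![1, 0, 0] a) {x : ChartSpace σ} (h : flowVector σ a x ≠ 0) :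
    0 < fderiv ℝ (fun y => μ (chart σ y)) x (flowVector σ a x) := by
  rw [hμ.fderiv_eq ha]
  exact ω.positive σ x _ h

theorem fderiv_eq_zero (hμ : IsCircleMomentMap ω μ) {σ : MaxCone T} {a : Ray k l → ℤ}
    (ha : IsCoeff σ ![1, 0, 0] a) {x : ChartSpace σ} (h : flowVector σ a x = 0) :
    fderiv ℝ (fun y => μ (chart σ y)) x = 0 := by
  ext v
  rw [hμ.fderiv_eq ha, h, smul_zero]
  exact (ω.form σ x).map_coord_zero 1 rfl

/-- The moment map is constant on the fixed points of the circle action in a chart. -/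
theorem eq_of_fixed (hμ : IsCircleMomentMap ω μ) {σ : MaxCone T} {a : Ray k l → ℤ}
    (ha : IsCoeff σ ![1, 0, 0] a) {x y : ChartSpace σ} (hx : flowVector σ a x = 0)
    (hy : flowVector σ a y = 0) : μ (chart σ x) = μ (chart σ y) := by
  -- The action is linear in the chart, so its fixed points form a linear subspace. It contains the
  -- segment from `x` to `y`, along which $d\mu$ vanishes.
  have hd : ∀ r : ℝ, HasDerivAt (fun r : ℝ => μ (chart σ (x + r • (y - x)))) 0 r := by
    intro r
    have h1 : HasDerivAt (fun r : ℝ => x + r • (y - x)) (y - x) r := by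
      simpa using ((hasDerivAt_id r).smul_const (y - x)).const_add x
    have h2 := ((hμ.differentiable_chart σ (x + r • (y - x))).hasFDerivAt).comp_hasDerivAt r h1
    rw [hμ.fderiv_eq_zero ha] at h2
    · exact h2
    · funext ρ
      have hx' := congrFun hx ρ
      have hy' := congrFun hy ρ
      simp only [flowVector, Pi.zero_apply] at hx' hy'
      simp only [flowVector, Pi.add_apply, Pi.smul_apply, Pi.sub_apply, Complex.real_smul,
        Pi.zero_apply]
      linear_combination (1 - (r : ℂ)) * hx' + (r : ℂ) * hy'
  have := is_const_of_deriv_eq_zero (fun r => (hd r).differentiableAt) (fun r => (hd r).deriv) 0 1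
  simpa using this

/-- The moment map is strictly monotone on the toric curves on which the circle acts
nontrivially. -/
theorem weight_mul_sub_pos (hμ : IsCircleMomentMap ω μ) {σ : MaxCone T} {a : Ray k l → ℤ}
    (ha : IsCoeff σ ![1, 0, 0] a) {x : ChartSpace σ} (ρ : {ρ // ρ ∈ σ.1}) (haρ : a ρ ≠ 0)
    (hxρ : x ρ ≠ 0) (hx : ∀ ρ', ρ' ≠ ρ → a ρ' ≠ 0 → x ρ' = 0) :
    0 < (a ρ : ℝ) * (μ (chart σ x) - μ (chart σ (Function.update x ρ 0))) := by
  classical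
  set e : ChartSpace σ := Pi.single ρ (x ρ) with he
  -- Only the coordinate of `ρ` is both nonzero and of nonzero weight, so along the radial segment
  -- the gradient is a multiple of the velocity `e`, with factor $a_\rho r$.
  have hflow : ∀ r : ℝ, flowVector σ a (Function.update x ρ 0 + r • e) = ((a ρ : ℝ) * r) • e := by
    intro r
    funext ρ'
    by_cases h : ρ' = ρ
    · subst h
      simp [flowVector, he, mul_assoc]
    · by_cases h' : a ρ' = 0
      · simp [flowVector, he, h, h']
      · simp [flowVector, he, h, hx ρ' h h']
  set g : ℝ → ℝ := fun r => μ (chart σ (Function.update x ρ 0 + r • e)) with hg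
  have hd : ∀ r : ℝ, HasDerivAt g
      (fderiv ℝ (fun y => μ (chart σ y)) (Function.update x ρ 0 + r • e) e) r := by
    intro r
    have h1 : HasDerivAt (fun r : ℝ => Function.update x ρ 0 + r • e) e r := by
      simpa using ((hasDerivAt_id r).smul_const e).const_add (Function.update x ρ 0)
    exact ((hμ.differentiable_chart σ _).hasFDerivAt).comp_hasDerivAt r h1
  have hmono : StrictMonoOn (fun r => (a ρ : ℝ) * g r) (Icc 0 1) := by
    refine strictMonoOn_of_deriv_pos (convex_Icc 0 1)
      (fun r _ => ((hd r).const_mul _).continuousAt.continuousWithinAt) ?_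
    intro r hr
    rw [interior_Icc] at hr
    rw [((hd r).const_mul _).deriv]
    have hne : ((a ρ : ℝ) * r) • e ≠ 0 := by
      rw [smul_ne_zero_iff]
      refine ⟨mul_ne_zero (by exact_mod_cast haρ) hr.1.ne', ?_⟩
      rw [he]
      exact fun h => hxρ (Pi.single_eq_zero_iff.1 h)
    have := hμ.fderiv_flowVector_pos ha (x := Function.update x ρ 0 + r • e)
      (by rw [hflow]; exact hne)
    rw [hflow, map_smul, smul_eq_mul] at this
    have h3 : (a ρ : ℝ) * r * fderiv ℝ (fun y => μ (chart σ y)) (Function.update x ρ 0 + r • e) e =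
      r * ((a ρ : ℝ) * fderiv ℝ (fun y => μ (chart σ y)) (Function.update x ρ 0 + r • e) e) := by
      ring
    rw [h3] at this
    exact pos_of_mul_pos_right this hr.1.le
  have h01 := hmono (left_mem_Icc.2 zero_le_one) (right_mem_Icc.2 zero_le_one) zero_lt_one
  have hx1 : Function.update x ρ 0 + (1 : ℝ) • e = x := by
    funext ρ'
    by_cases h : ρ' = ρ
    · subst h; simp [he]
    · simp [he, h]
  simp only [hg, hx1, zero_smul, add_zero] at h01
  rw [mul_sub, sub_pos]
  exact h01

end IsCircleMomentMap

/-! ### The extreme values and the image of the moment map -/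

/-- The maximal cone generated by `(-1,0,0)`, `(0,0,-1)` and `(0,-1,-1)`. -/
def coneInfLeft (T : MaximalTriangulation k l) : MaxCone T := ⟨_, IsMaxCone.infLeft⟩

/-- The maximal cone generated by `(1,0,0)`, `(0,0,-1)` and `(0,-1,-1)`. -/
def coneInfRight (T : MaximalTriangulation k l) : MaxCone T := ⟨_, IsMaxCone.infRight⟩

@[simp] theorem mem_coneInfLeft {ρ : Ray k l} :
    ρ ∈ (coneInfLeft T).1 ↔ ρ = Ray.xiInf ∨ ρ = Ray.zInf ∨ ρ = Ray.wInf := by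
  simp [coneInfLeft]

@[simp] theorem mem_coneInfRight {ρ : Ray k l} :
    ρ ∈ (coneInfRight T).1 ↔ ρ = Ray.xiZero ∨ ρ = Ray.zInf ∨ ρ = Ray.wInf := by
  simp [coneInfRight]

/-- The vector with coordinate `0` at the rays of `S` and coordinate `1` at the other rays. -/
def vanishingOn (S : Finset (Ray k l)) (ρ : Ray k l) : ℂ := if ρ ∈ S then 0 else 1

/-- The value of the moment map on the toric divisor of `(1,0,0)`. -/
def minValue (μ : ToricVariety T → ℝ) : ℝ :=
  μ (chart (coneInfRight T) fun ρ => vanishingOn {Ray.xiZero} ρ.1)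

/-- The value of the moment map on the toric divisor of `(-1,0,0)`. -/
def maxValue (μ : ToricVariety T → ℝ) : ℝ :=
  μ (chart (coneInfLeft T) fun ρ => vanishingOn {Ray.xiInf} ρ.1)

theorem vanishingOn_eq_one {S : Finset (Ray k l)} {σ : MaxCone T} (h : S ⊆ σ.1) (ρ : Ray k l)
    (hρ : ρ ∉ σ.1) : vanishingOn S ρ = 1 := if_neg fun h' => hρ (h h')

theorem flowVector_eq_zero_iff {σ : MaxCone T} {a : Ray k l → ℤ} {x : ChartSpace σ} :
    flowVector σ a x = 0 ↔ ∀ ρ, a ρ.1 ≠ 0 → x ρ = 0 := by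
  rw [funext_iff]
  refine forall_congr' fun ρ => ?_
  simp [flowVector, imp_iff_not_or]

theorem flowVector_xiZero_eq_zero_iff {σ : MaxCone T} (h : Ray.xiZero ∈ σ.1) {x : ChartSpace σ} :
    flowVector σ (Pi.single Ray.xiZero 1) x = 0 ↔ x ⟨Ray.xiZero, h⟩ = 0 := by
  rw [flowVector_eq_zero_iff]
  constructor
  · exact fun H => H _ (by simp)
  · rintro H ⟨ρ, hρ⟩ h'
    by_cases e : ρ = Ray.xiZero
    · subst e; exact H
    · simp [e] at h'

theorem flowVector_xiInf_eq_zero_iff {σ : MaxCone T} (h : Ray.xiInf ∈ σ.1) {x : ChartSpace σ} :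
    flowVector σ (-1 • Pi.single Ray.xiInf 1) x = 0 ↔ x ⟨Ray.xiInf, h⟩ = 0 := by
  rw [flowVector_eq_zero_iff]
  constructor
  · exact fun H => H _ (by simp)
  · rintro H ⟨ρ, hρ⟩ h'
    by_cases e : ρ = Ray.xiInf
    · subst e; exact H
    · simp [e] at h'

theorem flowVector_pair_eq_zero_iff {σ : MaxCone T} {ρ₁ ρ₂ : Ray k l} (hne : ρ₁ ≠ ρ₂)
    (h₁ : ρ₁ ∈ σ.1) (h₂ : ρ₂ ∈ σ.1) {x : ChartSpace σ} :
    flowVector σ (Pi.single ρ₂ 1 + -1 • Pi.single ρ₁ 1) x = 0 ↔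
      x ⟨ρ₁, h₁⟩ = 0 ∧ x ⟨ρ₂, h₂⟩ = 0 := by
  rw [flowVector_eq_zero_iff]
  constructor
  · exact fun H => ⟨H _ (by simp [hne]), H _ (by simp [hne.symm])⟩
  · rintro ⟨H₁, H₂⟩ ⟨ρ, hρ⟩ h'
    by_cases e : ρ = ρ₁
    · subst e; exact H₁
    · by_cases e' : ρ = ρ₂
      · subst e'; exact H₂
      · simp [e, e'] at h'

namespace IsCircleMomentMap

/-- In any chart that meets the divisor of $(1,0,0)$, the divisor is the whole fixed locus, and it
contains the reference point. -/
theorem eq_minValue (hμ : IsCircleMomentMap ω μ) {σ : MaxCone T} (h : Ray.xiZero ∈ σ.1)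
    {x : ChartSpace σ} (hx : x ⟨Ray.xiZero, h⟩ = 0) : μ (chart σ x) = minValue μ := by
  rw [minValue, ← chart_restrict_eq (σ := σ) (vanishingOn_eq_one (by simpa using h))
    (vanishingOn_eq_one (by simp [Finset.singleton_subset_iff]))]
  refine hμ.eq_of_fixed (isCoeff_of_xiZero_mem h) ?_ ?_
  · rwa [flowVector_xiZero_eq_zero_iff h]
  · rw [flowVector_xiZero_eq_zero_iff h]; simp [vanishingOn]

theorem eq_maxValue (hμ : IsCircleMomentMap ω μ) {σ : MaxCone T} (h : Ray.xiInf ∈ σ.1)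
    {x : ChartSpace σ} (hx : x ⟨Ray.xiInf, h⟩ = 0) : μ (chart σ x) = maxValue μ := by
  rw [maxValue, ← chart_restrict_eq (σ := σ) (vanishingOn_eq_one (by simpa using h))
    (vanishingOn_eq_one (by simp))]
  refine hμ.eq_of_fixed (isCoeff_of_xiInf_mem h) ?_ ?_
  · rwa [flowVector_xiInf_eq_zero_iff h]
  · rw [flowVector_xiInf_eq_zero_iff h]; simp [vanishingOn]

/-- The only nonzero weight is $+1$, so $\mu$ increases along the segment that leaves the divisor in
the direction of this coordinate. -/
theorem minValue_lt (hμ : IsCircleMomentMap ω μ) {σ : MaxCone T} (h : Ray.xiZero ∈ σ.1)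
    {x : ChartSpace σ} (hx : x ⟨Ray.xiZero, h⟩ ≠ 0) : minValue μ < μ (chart σ x) := by
  have := hμ.weight_mul_sub_pos (isCoeff_of_xiZero_mem h) ⟨Ray.xiZero, h⟩ (by simp) hx (by
    rintro ⟨ρ, hρ⟩ h1 h2
    simp only [ne_eq, Subtype.mk.injEq] at h1
    simp [h1] at h2)
  rw [hμ.eq_minValue h (Function.update_self _ _ _)] at this
  simpa using this

theorem lt_maxValue (hμ : IsCircleMomentMap ω μ) {σ : MaxCone T} (h : Ray.xiInf ∈ σ.1)
    {x : ChartSpace σ} (hx : x ⟨Ray.xiInf, h⟩ ≠ 0) : μ (chart σ x) < maxValue μ := by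
  have := hμ.weight_mul_sub_pos (isCoeff_of_xiInf_mem h) ⟨Ray.xiInf, h⟩ (by simp) hx (by
    rintro ⟨ρ, hρ⟩ h1 h2
    simp only [ne_eq, Subtype.mk.injEq] at h1
    simp [h1] at h2)
  rw [hμ.eq_maxValue h (Function.update_self _ _ _)] at this
  simpa using this

theorem mem_Icc (hμ : IsCircleMomentMap ω μ) (p : ToricVariety T) :
    μ p ∈ Icc (minValue μ) (maxValue μ) := by
  obtain ⟨σ, x, rfl⟩ := exists_chart_eq p
  -- Points of the dense torus lie in every chart, hence in one containing the divisor of $(1,0,0)$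
  -- and in one containing that of $(-1,0,0)$. The bounds found there extend by continuity.
  have hdense : Dense {y : ChartSpace σ | ∀ ρ, y ρ ≠ 0} := by
    have := dense_pi (univ : Set {ρ // ρ ∈ σ.1}) (s := fun _ => ({0}ᶜ : Set ℂ))
      (fun _ _ => dense_compl_singleton 0)
    convert this using 1
    ext y; simp
  refine hdense.induction (P := fun y => μ (chart σ y) ∈ Icc (minValue μ) (maxValue μ)) ?_
    (isClosed_Icc.preimage (hμ.continuous_chart σ)) x
  intro y hy
  have hne : ∀ ρ, homog σ y ρ ≠ 0 := by
    intro ρ h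
    have h' := mem_of_homog_eq_zero h
    rw [homog_of_mem σ y h'] at h
    exact hy _ h
  rw [chart_eq_toPoint]
  constructor
  · obtain ⟨x, hx, hx'⟩ := exists_chart_eq_toPoint (coneInfRight T)
      ⟨homog σ y, σ, fun _ => mem_of_homog_eq_zero⟩ (fun ρ h => absurd h (hne ρ))
    rw [← hx]
    refine (hμ.minValue_lt (by simp) ?_).le
    exact fun h => hne _ ((hx' _ _).1 h)
  · obtain ⟨x, hx, hx'⟩ := exists_chart_eq_toPoint (coneInfLeft T)
      ⟨homog σ y, σ, fun _ => mem_of_homog_eq_zero⟩ (fun ρ h => absurd h (hne ρ))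
    rw [← hx]
    refine (hμ.lt_maxValue (by simp) ?_).le
    exact fun h => hne _ ((hx' _ _).1 h)

/-- Over every point of `(ℙ¹ ∖ 0) × (ℙ¹ ∖ 0)` the moment map takes all values of the interval. -/
theorem exists_homogCoord_eq (hμ : IsCircleMomentMap ω μ) (y v : ℂ) {m : ℝ}
    (hm : m ∈ Icc (minValue μ) (maxValue μ)) :
    ∃ u : HomogCoord T, μ (toPoint u) = m ∧ (∀ q, u.1 (Ray.vertex q) = 1) ∧ u.1 Ray.zInf = y ∧
      u.1 Ray.wInf = v := by
  -- The path goes from `Ray.xiZero` coordinate $0$ up to $1$ in one chart, then from `Ray.xiInf`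
  -- coordinate $1$ down to $0$ in the other. The halves meet where both coordinates are $1$, and no
  -- other coordinate moves.
  let u : ℝ → ℝ → Ray k l → ℂ := fun r s => Ray.rec (fun _ => 1) y v r s
  let L : ℝ → ChartSpace (coneInfLeft T) := fun s ρ => u 1 s ρ
  let R : ℝ → ChartSpace (coneInfRight T) := fun r ρ => u r 1 ρ
  have hLm : Ray.xiInf ∈ (coneInfLeft T).1 := by simp
  have hRm : Ray.xiZero ∈ (coneInfRight T).1 := by simp
  have hL1 : ∀ s ρ, ρ ∉ (coneInfLeft T).1 → u 1 s ρ = 1 := by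
    rintro s (q | _ | _ | _ | _) h <;> simp at h <;> simp [u]
  have hR1 : ∀ r ρ, ρ ∉ (coneInfRight T).1 → u r 1 ρ = 1 := by
    rintro s (q | _ | _ | _ | _) h <;> simp at h <;> simp [u]
  have hLc : Continuous L := by
    refine continuous_pi fun ρ => ?_
    rcases ρ with ⟨_ | _ | _ | _ | _, h⟩ <;> simp only [L, u] <;> fun_prop
  have hRc : Continuous R := by
    refine continuous_pi fun ρ => ?_
    rcases ρ with ⟨_ | _ | _ | _ | _, h⟩ <;> simp only [R, u] <;> fun_prop
  have hmid : chart _ (L 1) = chart _ (R 1) := chart_restrict_eq (hL1 1) (hR1 1)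
  have hL0 : μ (chart _ (L 0)) = maxValue μ := hμ.eq_maxValue hLm (by simp [L, u])
  have hR0 : μ (chart _ (R 0)) = minValue μ := hμ.eq_minValue hRm (by simp [R, u])
  rcases le_total m (μ (chart _ (L 1))) with h | h
  · rw [hmid] at h
    obtain ⟨r, -, hr⟩ := intermediate_value_Icc (zero_le_one' ℝ)
      ((hμ.continuous_chart _).comp hRc).continuousOn
      (show m ∈ Icc (μ (chart _ (R 0))) (μ (chart _ (R 1))) from ⟨hR0 ▸ hm.1, h⟩)
    refine ⟨⟨homog (coneInfRight T) (R r), _, fun _ => mem_of_homog_eq_zero⟩, hr, fun q => ?_, ?_, ?_⟩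
    · exact homog_of_notMem (ρ := Ray.vertex q) (coneInfRight T) (R r) (by simp)
    · exact homog_of_mem (ρ := Ray.zInf) (coneInfRight T) (R r) (by simp)
    · exact homog_of_mem (ρ := Ray.wInf) (coneInfRight T) (R r) (by simp)
  · obtain ⟨r, -, hr⟩ := intermediate_value_Icc' (zero_le_one' ℝ)
      ((hμ.continuous_chart _).comp hLc).continuousOn
      (show m ∈ Icc (μ (chart _ (L 1))) (μ (chart _ (L 0))) from ⟨h, hL0 ▸ hm.2⟩)
    refine ⟨⟨homog (coneInfLeft T) (L r), _, fun _ => mem_of_homog_eq_zero⟩, hr, fun q => ?_, ?_, ?_⟩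
    · exact homog_of_notMem (ρ := Ray.vertex q) (coneInfLeft T) (L r) (by simp)
    · exact homog_of_mem (ρ := Ray.zInf) (coneInfLeft T) (L r) (by simp)
    · exact homog_of_mem (ρ := Ray.wInf) (coneInfLeft T) (L r) (by simp)

theorem range_eq_Icc (hμ : IsCircleMomentMap ω μ) :
    range μ = Icc (minValue μ) (maxValue μ) := by
  refine subset_antisymm (range_subset_iff.2 hμ.mem_Icc) fun m hm => ?_
  obtain ⟨u, hu, -⟩ := hμ.exists_homogCoord_eq 0 0 hm
  exact ⟨_, hu⟩

theorem minValue_lt_maxValue (hμ : IsCircleMomentMap ω μ) : minValue μ < maxValue μ :=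
  (hμ.mem_Icc (chart (coneInfLeft T) 1)).1.trans_lt
    (hμ.lt_maxValue (by simp) (by simp))

end IsCircleMomentMap

end Moment

/-! ### The values of the moment map at the fixed curves -/

section FixedCurves

variable {T : MaximalTriangulation k l} {ω : ToricKahlerForm T} {μ : ToricVariety T → ℝ}

/-- The maximal cone generated by `(i,0,1)`, `(i+1,0,1)` and `(0,-1,-1)`. -/
def coneBotEdge (T : MaximalTriangulation k l) (i : Fin k) : MaxCone T := ⟨_, IsMaxCone.botEdge i⟩

/-- The maximal cone generated by `(j,1,1)`, `(j+1,1,1)` and `(0,0,-1)`. -/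
def coneTopEdge (T : MaximalTriangulation k l) (j : Fin l) : MaxCone T := ⟨_, IsMaxCone.topEdge j⟩

@[simp] theorem mem_coneBotEdge {i : Fin k} {ρ : Ray k l} :
    ρ ∈ (coneBotEdge T i).1 ↔ ρ = Ray.bot i.castSucc ∨ ρ = Ray.bot i.succ ∨ ρ = Ray.wInf := by
  simp [coneBotEdge]

@[simp] theorem mem_coneTopEdge {j : Fin l} {ρ : Ray k l} :
    ρ ∈ (coneTopEdge T j).1 ↔ ρ = Ray.top j.castSucc ∨ ρ = Ray.top j.succ ∨ ρ = Ray.zInf := by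
  simp [coneTopEdge]

/-- The value of the moment map on the toric curve of the cone over a horizontal edge of the lower
side of the trapezoid. -/
def botValue (μ : ToricVariety T → ℝ) (i : Fin k) : ℝ :=
  μ (chart (coneBotEdge T i) fun ρ => vanishingOn {Ray.bot i.castSucc, Ray.bot i.succ} ρ.1)

/-- The value of the moment map on the toric curve of the cone over a horizontal edge of the upper
side of the trapezoid. -/
def topValue (μ : ToricVariety T → ℝ) (j : Fin l) : ℝ :=
  μ (chart (coneTopEdge T j) fun ρ => vanishingOn {Ray.top j.castSucc, Ray.top j.succ} ρ.1)

/-- An integer sequence that starts at `0` and has steps `0` and `1` takes every step. -/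
theorem exists_step_of_lt {f : ℕ → ℕ} {N i : ℕ} (h0 : f 0 = 0)
    (hf : ∀ n < N, f (n + 1) = f n ∨ f (n + 1) = f n + 1) (hi : i < f N) :
    ∃ n < N, f n = i ∧ f (n + 1) = i + 1 := by
  induction N with
  | zero => omega
  | succ N ih =>
    by_cases h : i < f N
    · obtain ⟨n, hn, h1⟩ := ih (fun n hn => hf n (by omega)) h
      exact ⟨n, by omega, h1⟩
    · have := hf N (by omega)
      exact ⟨N, by omega, by omega, by omega⟩

namespace IsCircleMomentMap

theorem eq_botValue (hμ : IsCircleMomentMap ω μ) {σ : MaxCone T} {i : Fin k}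
    (h : Ray.bot i.castSucc ∈ σ.1) (h' : Ray.bot i.succ ∈ σ.1) {x : ChartSpace σ}
    (hx : x ⟨_, h⟩ = 0) (hx' : x ⟨_, h'⟩ = 0) : μ (chart σ x) = botValue μ i := by
  have hne : (Ray.bot i.castSucc : Ray k l) ≠ Ray.bot i.succ := by simp [Fin.ext_iff]
  rw [botValue, ← chart_restrict_eq (σ := σ)
    (vanishingOn_eq_one (by simp [Finset.insert_subset_iff, h, h']))
    (vanishingOn_eq_one (by simp [Finset.insert_subset_iff]))]
  refine hμ.eq_of_fixed (isCoeff_of_bot_mem (by simp) h h') ?_ ?_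
  · rw [flowVector_pair_eq_zero_iff hne h h']; exact ⟨hx, hx'⟩
  · rw [flowVector_pair_eq_zero_iff hne h h']; simp [vanishingOn]

theorem eq_topValue (hμ : IsCircleMomentMap ω μ) {σ : MaxCone T} {j : Fin l}
    (h : Ray.top j.castSucc ∈ σ.1) (h' : Ray.top j.succ ∈ σ.1) {x : ChartSpace σ}
    (hx : x ⟨_, h⟩ = 0) (hx' : x ⟨_, h'⟩ = 0) : μ (chart σ x) = topValue μ j := by
  have hne : (Ray.top j.castSucc : Ray k l) ≠ Ray.top j.succ := by simp [Fin.ext_iff]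
  rw [topValue, ← chart_restrict_eq (σ := σ)
    (vanishingOn_eq_one (by simp [Finset.insert_subset_iff, h, h']))
    (vanishingOn_eq_one (by simp [Finset.insert_subset_iff]))]
  refine hμ.eq_of_fixed (isCoeff_of_top_mem (by simp) h h') ?_ ?_
  · rw [flowVector_pair_eq_zero_iff hne h h']; exact ⟨hx, hx'⟩
  · rw [flowVector_pair_eq_zero_iff hne h h']; simp [vanishingOn]

/-- If `(1,0,0)` is the difference of the generators of `ρ₂` and `ρ₁`, then the moment map increases
away from the origin along the axis of `ρ₂`, and decreases along the axis of `ρ₁`. -/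
theorem lt_and_lt_of_pair (hμ : IsCircleMomentMap ω μ) {σ : MaxCone T} {ρ₁ ρ₂ : Ray k l}
    (hne : ρ₁ ≠ ρ₂) (h₁ : ρ₁ ∈ σ.1) (h₂ : ρ₂ ∈ σ.1)
    (ha : IsCoeff σ ![1, 0, 0] (Pi.single ρ₂ 1 + -1 • Pi.single ρ₁ 1)) {x y : ChartSpace σ}
    (hx₁ : x ⟨ρ₁, h₁⟩ = 0) (hx₂ : x ⟨ρ₂, h₂⟩ ≠ 0) (hy₁ : y ⟨ρ₁, h₁⟩ ≠ 0)
    (hy₂ : y ⟨ρ₂, h₂⟩ = 0) :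
    μ (chart σ 0) < μ (chart σ x) ∧ μ (chart σ y) < μ (chart σ 0) := by
  have h0 : flowVector σ (Pi.single ρ₂ 1 + -1 • Pi.single ρ₁ 1) 0 = 0 := by
    rw [flowVector_pair_eq_zero_iff hne h₁ h₂]; simp
  constructor
  · have := hμ.weight_mul_sub_pos ha ⟨ρ₂, h₂⟩ (by simp [hne.symm]) hx₂ (by
      rintro ⟨ρ, hρ⟩ h h'
      simp only [ne_eq, Subtype.mk.injEq] at h
      by_cases e : ρ = ρ₁
      · subst e; exact hx₁
      · simp [h, e] at h')
    -- Without its `ρ₂` coordinate the point is fixed by the circle, so it has the value of the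
    -- origin, whatever its third coordinate.
    rw [hμ.eq_of_fixed (x := Function.update x ⟨ρ₂, h₂⟩ 0) (y := 0) ha _ h0] at this
    · simpa [hne.symm] using this
    · rw [flowVector_pair_eq_zero_iff hne h₁ h₂]
      simp [hne, hx₁]
  · have := hμ.weight_mul_sub_pos ha ⟨ρ₁, h₁⟩ (by simp [hne]) hy₁ (by
      rintro ⟨ρ, hρ⟩ h h'
      simp only [ne_eq, Subtype.mk.injEq] at h
      by_cases e : ρ = ρ₂
      · subst e; exact hy₂
      · simp [h, e] at h')
    rw [hμ.eq_of_fixed (x := Function.update y ⟨ρ₁, h₁⟩ 0) (y := 0) ha _ h0] at this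
    · simpa [hne] using this
    · rw [flowVector_pair_eq_zero_iff hne h₁ h₂]
      simp [hne.symm, hy₂]

/-- The toric curves of the two slanted sides are the axes of weights $+1$ and $-1$ of the chart: on
the curve of the left side the free coordinate has weight $+1$, on that of the right side $-1$. -/
theorem lt_and_lt_of_isStep (hμ : IsCircleMomentMap ω μ) {σ : MaxCone T} {a a' : Fin (k + 1)}
    {b b' : Fin (l + 1)} (hs : IsStep a b a' b') (ha : Ray.bot a ∈ σ.1) (hb : Ray.top b ∈ σ.1)
    (ha' : Ray.bot a' ∈ σ.1) (hb' : Ray.top b' ∈ σ.1) :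
    μ (chart σ 0) < μ (chart σ fun ρ => vanishingOn {Ray.bot a, Ray.top b} ρ.1) ∧
      μ (chart σ fun ρ => vanishingOn {Ray.bot a', Ray.top b'} ρ.1) < μ (chart σ 0) := by
  rcases hs with ⟨h1, h2⟩ | ⟨h1, h2⟩
  · have hne : a ≠ a' := fun h => by rw [h] at h1; omega
    exact hμ.lt_and_lt_of_pair (by simpa using hne) ha ha' (isCoeff_of_bot_mem h1 ha ha')
      (by simp [vanishingOn]) (by simp [vanishingOn, hne.symm]) (by simp [vanishingOn, hne])
      (by simp [vanishingOn])
  · have hne : b ≠ b' := fun h => by rw [h] at h2; omega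
    exact hμ.lt_and_lt_of_pair (by simpa using hne) hb hb' (isCoeff_of_top_mem h2 hb hb')
      (by simp [vanishingOn]) (by simp [vanishingOn, hne.symm]) (by simp [vanishingOn, hne])
      (by simp [vanishingOn])

/-- The values of the moment map at the fixed curves are ordered as the triangles of the strip. -/
theorem exists_order (hμ : IsCircleMomentMap ω μ) (hkl : 0 < k + l) :
    ∃ (N : Fin k ⊕ Fin l → ℕ) (m : ℕ → ℝ), Function.Injective N ∧ (∀ q, N q < k + l) ∧
      StrictAntiOn m (Iio (k + l)) ∧ (∀ n < k + l, m n ∈ Ioo (minValue μ) (maxValue μ)) ∧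
      ∀ q, Sum.elim (botValue μ) (topValue μ) q = m (N q) := by
  obtain ⟨A, B, hsum, hAB⟩ := T.exists_strip hkl
  have hτ : ∀ n, ∃ τ : MaxCone T, n < k + l → Ray.bot (A n) ∈ τ.1 ∧ Ray.top (B n) ∈ τ.1 ∧
      Ray.bot (A (n + 1)) ∈ τ.1 ∧ Ray.top (B (n + 1)) ∈ τ.1 := by
    intro n
    by_cases hn : n < k + l
    · exact ⟨⟨_, IsMaxCone.triangle _ (hAB n hn).2⟩, fun _ => by simp⟩
    -- An arbitrary cone; no use is made of indices beyond the last triangle.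
    · exact ⟨coneInfLeft T, fun h => absurd h hn⟩
  choose τ hτ using hτ
  have hlt : ∀ n (hn : n < k + l), _ := fun n hn =>
    hμ.lt_and_lt_of_isStep (hAB n hn).1 (hτ n hn).1 (hτ n hn).2.1 (hτ n hn).2.2.1 (hτ n hn).2.2.2
  have hbot : ∀ i : Fin k, ∃ n < k + l, (A n : ℕ) = i ∧ (A (n + 1) : ℕ) = i + 1 := by
    intro i
    refine exists_step_of_lt (f := fun n => (A n : ℕ)) ?_ ?_ ?_
    · have := hsum 0 (by omega); omega
    · intro n hn
      rcases (hAB n hn).1 with h | h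
      · exact Or.inr h.1
      · exact Or.inl (congrArg Fin.val h.1)
    · have := hsum (k + l) le_rfl
      have := (A (k + l)).2
      have := (B (k + l)).2
      have := i.2
      omega
  have htop : ∀ j : Fin l, ∃ n < k + l, (B n : ℕ) = j ∧ (B (n + 1) : ℕ) = j + 1 := by
    intro i
    refine exists_step_of_lt (f := fun n => (B n : ℕ)) ?_ ?_ ?_
    · have := hsum 0 (by omega); omega
    · intro n hn
      rcases (hAB n hn).1 with h | h
      · exact Or.inl (congrArg Fin.val h.2)
      · exact Or.inr h.2
    · have := hsum (k + l) le_rfl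
      have := (A (k + l)).2
      have := (B (k + l)).2
      have := i.2
      omega
  choose Nb hNb using hbot
  choose Nt hNt using htop
  -- `N` sends a horizontal edge to the index of its triangle. It is injective because $A_n+B_n=n$
  -- lets exactly one of the two sequences advance at each step.
  refine ⟨Sum.elim Nb Nt, fun n => μ (chart (τ n) 0), ?_, ?_, ?_, ?_, ?_⟩
  · rintro (i | i) (j | j) h <;> simp only [Sum.elim_inl, Sum.elim_inr] at h
    · have h1 := hNb i
      have h2 := hNb j
      rw [h] at h1
      exact congrArg _ (Fin.ext (by omega))
    · have h1 := hNb i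
      have h2 := hNt j
      rw [h] at h1
      have := hsum _ h2.1.le
      have := hsum _ (Nat.succ_le_of_lt h2.1)
      simp only [Nat.succ_eq_add_one] at this
      omega
    · have h1 := hNt i
      have h2 := hNb j
      rw [h] at h1
      have := hsum _ h2.1.le
      have := hsum _ (Nat.succ_le_of_lt h2.1)
      simp only [Nat.succ_eq_add_one] at this
      omega
    · have h1 := hNt i
      have h2 := hNt j
      rw [h] at h1
      exact congrArg _ (Fin.ext (by omega))
  · rintro (i | i)
    exacts [(hNb i).1, (hNt i).1]
  · have hstep : ∀ n, n + 1 < k + l → μ (chart (τ (n + 1)) 0) < μ (chart (τ n) 0) := by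
      intro n hn
      -- The intermediate point lies on the toric curve of the shared slanted edge: the left side of
      -- triangle $n+1$ is the right side of triangle $n$.
      refine (hlt (n + 1) hn).1.trans ?_
      have h := hτ n (by omega)
      have h' := hτ (n + 1) hn
      rw [chart_restrict_eq (τ := τ n)
        (vanishingOn_eq_one (by simp [Finset.insert_subset_iff, h']))
        (vanishingOn_eq_one (by simp [Finset.insert_subset_iff, h]))]
      exact (hlt n (by omega)).2
    have hind : ∀ n d, n + (d + 1) < k + l →
        μ (chart (τ (n + (d + 1))) 0) < μ (chart (τ n) 0) := by
      intro n d
      induction d with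
      | zero => exact hstep n
      | succ d ih => exact fun h => (hstep (n + (d + 1)) h).trans (ih (by omega))
    intro n _ n' hn' hlt
    obtain ⟨d, rfl⟩ := Nat.exists_eq_add_of_lt hlt
    exact hind n d hn'
  -- Strictness at both ends comes from the points on the two slanted sides, whose values lie
  -- strictly on either side of that of the origin.
  · exact fun n hn => ⟨(hμ.mem_Icc _).1.trans_lt (hlt n hn).2, (hlt n hn).1.trans_le (hμ.mem_Icc _).2⟩
  · rintro (i | j)
    · obtain ⟨hn, h1, h2⟩ := hNb i
      have e1 : A (Nb i) = i.castSucc := Fin.ext h1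
      have e2 : A (Nb i + 1) = i.succ := Fin.ext h2
      have h := hτ _ hn
      rw [e1, e2] at h
      exact (hμ.eq_botValue h.1 h.2.2.1 rfl rfl).symm
    · obtain ⟨hn, h1, h2⟩ := hNt j
      have e1 : B (Nt j) = j.castSucc := Fin.ext h1
      have e2 : B (Nt j + 1) = j.succ := Fin.ext h2
      have h := hτ _ hn
      rw [e1, e2] at h
      exact (hμ.eq_topValue h.2.1 h.2.2.2 rfl rfl).symm

theorem injective_elim (hμ : IsCircleMomentMap ω μ) (hkl : 0 < k + l) :
    Function.Injective (Sum.elim (botValue μ) (topValue μ)) := by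
  obtain ⟨N, m, hN, hlt, hm, -, h⟩ := hμ.exists_order hkl
  intro q q' hq
  rw [h, h] at hq
  exact hN (hm.injOn (hlt q) (hlt q') hq)

theorem elim_mem_Ioo (hμ : IsCircleMomentMap ω μ) (hkl : 0 < k + l) (q : Fin k ⊕ Fin l) :
    Sum.elim (botValue μ) (topValue μ) q ∈ Ioo (minValue μ) (maxValue μ) := by
  obtain ⟨N, m, -, hlt, -, hm, h⟩ := hμ.exists_order hkl
  rw [h]
  exact hm _ (hlt q)

theorem flowVector_eq_zero (hμ : IsCircleMomentMap ω μ) {σ : MaxCone T} {a : Ray k l → ℤ}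
    (ha : IsCoeff σ ![1, 0, 0] a) {x : ChartSpace σ}
    (h : fderiv ℝ (fun y => μ (chart σ y)) x = 0) : flowVector σ a x = 0 := by
  by_contra h'
  have := hμ.fderiv_flowVector_pos ha h'
  rw [h] at this
  exact lt_irrefl _ this

/-- The critical points of the moment map in a chart lie on the two extremal divisors and on the
fixed curves. -/
theorem critical_cases (hμ : IsCircleMomentMap ω μ) {σ : MaxCone T} {x : ChartSpace σ}
    (h : fderiv ℝ (fun y => μ (chart σ y)) x = 0) :
    μ (chart σ x) = minValue μ ∨ μ (chart σ x) = maxValue μ ∨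
      (∃ i : Fin k, homog σ x (Ray.bot i.castSucc) = 0 ∧ μ (chart σ x) = botValue μ i) ∨
      ∃ j : Fin l, homog σ x (Ray.top j.castSucc) = 0 ∧ μ (chart σ x) = topValue μ j := by
  rcases σ.2.mem_cases with h1 | h1 | ⟨i, h1, h2⟩ | ⟨j, h1, h2⟩
  · have := hμ.flowVector_eq_zero (isCoeff_of_xiInf_mem h1) h
    rw [flowVector_xiInf_eq_zero_iff h1] at this
    exact Or.inr (Or.inl (hμ.eq_maxValue h1 this))
  · have := hμ.flowVector_eq_zero (isCoeff_of_xiZero_mem h1) h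
    rw [flowVector_xiZero_eq_zero_iff h1] at this
    exact Or.inl (hμ.eq_minValue h1 this)
  · have := hμ.flowVector_eq_zero (isCoeff_of_bot_mem (by simp) h1 h2) h
    rw [flowVector_pair_eq_zero_iff (by simp [Fin.ext_iff]) h1 h2] at this
    exact Or.inr (Or.inr (Or.inl ⟨i, (homog_of_mem σ x h1).trans this.1,
      hμ.eq_botValue h1 h2 this.1 this.2⟩))
  · have := hμ.flowVector_eq_zero (isCoeff_of_top_mem (by simp) h1 h2) h
    rw [flowVector_pair_eq_zero_iff (by simp [Fin.ext_iff]) h1 h2] at this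
    exact Or.inr (Or.inr (Or.inr ⟨j, (homog_of_mem σ x h1).trans this.1,
      hμ.eq_topValue h1 h2 this.1 this.2⟩))

theorem fderiv_eq_zero_of_bot (hμ : IsCircleMomentMap ω μ) {σ : MaxCone T} {i : Fin k}
    (h : Ray.bot i.castSucc ∈ σ.1) (h' : Ray.bot i.succ ∈ σ.1) {x : ChartSpace σ}
    (hx : x ⟨_, h⟩ = 0) (hx' : x ⟨_, h'⟩ = 0) :
    fderiv ℝ (fun y => μ (chart σ y)) x = 0 :=
  hμ.fderiv_eq_zero (isCoeff_of_bot_mem (by simp) h h')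
    ((flowVector_pair_eq_zero_iff (by simp [Fin.ext_iff]) h h').2 ⟨hx, hx'⟩)

theorem fderiv_eq_zero_of_top (hμ : IsCircleMomentMap ω μ) {σ : MaxCone T} {j : Fin l}
    (h : Ray.top j.castSucc ∈ σ.1) (h' : Ray.top j.succ ∈ σ.1) {x : ChartSpace σ}
    (hx : x ⟨_, h⟩ = 0) (hx' : x ⟨_, h'⟩ = 0) :
    fderiv ℝ (fun y => μ (chart σ y)) x = 0 :=
  hμ.fderiv_eq_zero (isCoeff_of_top_mem (by simp) h h')
    ((flowVector_pair_eq_zero_iff (by simp [Fin.ext_iff]) h h').2 ⟨hx, hx'⟩)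

/-- The interior critical values of the moment map. -/
theorem criticalValues_inter_interior (hμ : IsCircleMomentMap ω μ) (hkl : 0 < k + l) :
    criticalValues μ ∩ interior (range μ) = range (botValue μ) ∪ range (topValue μ) := by
  rw [hμ.range_eq_Icc, interior_Icc]
  have key : ∀ (σ : MaxCone T) (x : ChartSpace σ),
      fderiv ℝ (fun y => μ (chart σ y)) x = 0 → μ (chart σ x) ∈ criticalValues μ := by
    refine fun σ x h => ⟨_, ⟨σ, x, rfl, fun hs => ?_⟩, rfl⟩
    obtain ⟨v, hv⟩ := hs 1
    rw [h] at hv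
    exact zero_ne_one hv
  ext m
  constructor
  · rintro ⟨⟨p, ⟨σ, x, rfl, hx⟩, rfl⟩, hm⟩
    have h0 : fderiv ℝ (fun y => μ (chart σ y)) x = 0 := by
      by_contra h
      refine hx ?_
      have := LinearMap.surjective (f := (fderiv ℝ (fun y => μ (chart σ y)) x).toLinearMap)
        (fun h' => h (ContinuousLinearMap.coe_injective h'))
      exact this
    rcases hμ.critical_cases h0 with h | h | ⟨i, -, h⟩ | ⟨j, -, h⟩
    · exact absurd h hm.1.ne'
    · exact absurd h hm.2.ne
    · exact Or.inl ⟨i, h.symm⟩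
    · exact Or.inr ⟨j, h.symm⟩
  · rintro (⟨i, rfl⟩ | ⟨j, rfl⟩)
    · exact ⟨key _ _ (hμ.fderiv_eq_zero_of_bot (i := i) (by simp) (by simp) (by simp [vanishingOn])
        (by simp [vanishingOn])), hμ.elim_mem_Ioo hkl (Sum.inl i)⟩
    · exact ⟨key _ _ (hμ.fderiv_eq_zero_of_top (j := j) (by simp) (by simp) (by simp [vanishingOn])
        (by simp [vanishingOn])), hμ.elim_mem_Ioo hkl (Sum.inr j)⟩

theorem eq_botValue_of_mem_toricDivisor (hμ : IsCircleMomentMap ω μ) (i : Fin k)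
    {p : ToricVariety T} (h : p ∈ toricDivisor T (Ray.bot i.castSucc))
    (h' : p ∈ toricDivisor T (Ray.bot i.succ)) : μ p = botValue μ i := by
  obtain ⟨σ, x, rfl, hx, hx'⟩ := exists_chart_eq_of_mem_toricDivisor h h'
  have hm := mem_of_homog_eq_zero hx
  have hm' := mem_of_homog_eq_zero hx'
  exact hμ.eq_botValue hm hm' ((homog_of_mem σ x hm).symm.trans hx)
    ((homog_of_mem σ x hm').symm.trans hx')

theorem eq_topValue_of_mem_toricDivisor (hμ : IsCircleMomentMap ω μ) (j : Fin l)
    {p : ToricVariety T} (h : p ∈ toricDivisor T (Ray.top j.castSucc))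
    (h' : p ∈ toricDivisor T (Ray.top j.succ)) : μ p = topValue μ j := by
  obtain ⟨σ, x, rfl, hx, hx'⟩ := exists_chart_eq_of_mem_toricDivisor h h'
  have hm := mem_of_homog_eq_zero hx
  have hm' := mem_of_homog_eq_zero hx'
  exact hμ.eq_topValue hm hm' ((homog_of_mem σ x hm).symm.trans hx)
    ((homog_of_mem σ x hm').symm.trans hx')

end IsCircleMomentMap

end FixedCurves

/-! ### The coordinates of the fibration -/

section Fibration

variable {T : MaximalTriangulation k l} {ω : ToricKahlerForm T} {μ : ToricVariety T → ℝ}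

/-- The character $(0,-1,1)$ pairs to $1$ with each $(i,0,1)$, to $-1$ with $(0,0,-1)$, and to $0$
with all other generators. -/
theorem zFun_toPoint (u : HomogCoord T) : zFun (toPoint u) =
    if u.1 Ray.zInf = 0 then OnePoint.infty
    else (((∏ i, u.1 (Ray.bot i)) / u.1 Ray.zInf : ℂ) : OnePoint ℂ) := by
  have h1 : ∏ ρ, u.1 ρ ^ (-Ray.pairing ![0, -1, 1] ρ).toNat = u.1 Ray.zInf := by
    rw [Fintype.prod_eq_single Ray.zInf]
    · simp [Ray.pairing, Fin.sum_univ_three, Ray.gen]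
    · rintro ((i | j) | _ | _ | _ | _) h <;>
        simp [Ray.pairing, Fin.sum_univ_three, Ray.gen, Vertex.coord] at h ⊢
  have h2 : ∏ ρ, u.1 ρ ^ (Ray.pairing ![0, -1, 1] ρ).toNat = ∏ i, u.1 (Ray.bot i) := by
    symm
    refine Fintype.prod_of_injective Ray.bot (fun i i' h => by simpa using h) _ _ ?_ ?_
    · rintro ((i | j) | _ | _ | _ | _) h <;>
        simp [Ray.pairing, Fin.sum_univ_three, Ray.gen, Vertex.coord] at h ⊢
    · intro i
      simp [Ray.pairing, Fin.sum_univ_three, Ray.gen, Vertex.coord]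
  change (if ∏ ρ, u.1 ρ ^ (-Ray.pairing ![0, -1, 1] ρ).toNat = 0 then OnePoint.infty
    else (((∏ ρ, u.1 ρ ^ (Ray.pairing ![0, -1, 1] ρ).toNat) /
      ∏ ρ, u.1 ρ ^ (-Ray.pairing ![0, -1, 1] ρ).toNat : ℂ) : OnePoint ℂ)) = _
  rw [h1, h2]

theorem wFun_toPoint (u : HomogCoord T) : wFun (toPoint u) =
    if u.1 Ray.wInf = 0 then OnePoint.infty
    else (((∏ j, u.1 (Ray.top j)) / u.1 Ray.wInf : ℂ) : OnePoint ℂ) := by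
  have h1 : ∏ ρ, u.1 ρ ^ (-Ray.pairing ![0, 1, 0] ρ).toNat = u.1 Ray.wInf := by
    rw [Fintype.prod_eq_single Ray.wInf]
    · simp [Ray.pairing, Fin.sum_univ_three, Ray.gen]
    · rintro ((i | j) | _ | _ | _ | _) h <;>
        simp [Ray.pairing, Fin.sum_univ_three, Ray.gen, Vertex.coord] at h ⊢
  have h2 : ∏ ρ, u.1 ρ ^ (Ray.pairing ![0, 1, 0] ρ).toNat = ∏ j, u.1 (Ray.top j) := by
    symm
    refine Fintype.prod_of_injective Ray.top (fun i i' h => by simpa using h) _ _ ?_ ?_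
    · rintro ((i | j) | _ | _ | _ | _) h <;>
        simp [Ray.pairing, Fin.sum_univ_three, Ray.gen, Vertex.coord] at h ⊢
    · intro i
      simp [Ray.pairing, Fin.sum_univ_three, Ray.gen, Vertex.coord]
  change (if ∏ ρ, u.1 ρ ^ (-Ray.pairing ![0, 1, 0] ρ).toNat = 0 then OnePoint.infty
    else (((∏ ρ, u.1 ρ ^ (Ray.pairing ![0, 1, 0] ρ).toNat) /
      ∏ ρ, u.1 ρ ^ (-Ray.pairing ![0, 1, 0] ρ).toNat : ℂ) : OnePoint ℂ)) = _
  rw [h1, h2]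

/-! ### The logarithmic distance to $1$ in the coordinate of the compactified base -/

theorem logDistOne_coe (a : ℂ) : logDistOne (a : OnePoint ℂ) = ENNReal.log ‖a - 1‖ₑ := rfl

theorem logDistOne_infty : logDistOne OnePoint.infty = ⊤ := rfl

theorem compactCoord_logDistOne_infty : compactCoord (logDistOne OnePoint.infty) = 1 := rfl

/-- In this coordinate the singularity of the logarithm at $a=1$ disappears: the expression is
smooth on all of $\mathbb C$. -/
theorem compactCoord_logDistOne_coe (a : ℂ) :
    compactCoord (logDistOne (a : OnePoint ℂ)) = ‖a - 1‖ ^ 2 / (1 + ‖a - 1‖ ^ 2) := by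
  rw [logDistOne_coe]
  by_cases h : a - 1 = 0
  · rw [h]
    simp only [enorm_zero, ENNReal.log_zero, norm_zero]
    change (0 : ℝ) = _
    simp
  · have hn : 0 < ‖a - 1‖ := norm_pos_iff.2 h
    have : ENNReal.log ‖a - 1‖ₑ = ((Real.log ‖a - 1‖ : ℝ) : EReal) := by
      rw [ENNReal.log_pos_real (by simpa using h) (by simp)]
      simp
    rw [this]
    change Real.exp (2 * Real.log ‖a - 1‖) / (1 + Real.exp (2 * Real.log ‖a - 1‖)) = _
    rw [two_mul, Real.exp_add, Real.exp_log hn, sq]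

theorem compactCoord_logDistOne_mem_Icc (ζ : OnePoint ℂ) :
    compactCoord (logDistOne ζ) ∈ Icc (0 : ℝ) 1 := by
  induction ζ using OnePoint.rec with
  | infty => rw [compactCoord_logDistOne_infty]; simp
  | coe a =>
    rw [compactCoord_logDistOne_coe]
    exact ⟨by positivity, div_le_one_of_le₀ (by linarith) (by positivity)⟩

theorem compactCoord_bot : compactCoord ⊥ = 0 := rfl

theorem compactCoord_top : compactCoord ⊤ = 1 := rfl

theorem logDistOne_zero : logDistOne ((0 : ℂ) : OnePoint ℂ) = 0 := by
  rw [logDistOne_coe]; simp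

/-- Every value of `log |ζ - 1|` is attained at the inverse of a complex number. -/
theorem exists_logDistOne_inv_eq (b : EReal) : ∃ y : ℂ,
    logDistOne (if y = 0 then OnePoint.infty else ((1 / y : ℂ) : OnePoint ℂ)) = b := by
  induction b using EReal.rec with
  | bot => exact ⟨1, by simp [logDistOne_coe]⟩
  | top => exact ⟨0, by simp [logDistOne_infty]⟩
  | coe b =>
    have hpos : (1 + Real.exp b : ℝ) ≠ 0 := by positivity
    have hne : ((1 + Real.exp b : ℝ) : ℂ) ≠ 0 := by exact_mod_cast hpos
    -- Chosen so that $1/y-1=e^b$.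
    refine ⟨((1 + Real.exp b : ℝ) : ℂ)⁻¹, ?_⟩
    rw [if_neg (inv_ne_zero hne), logDistOne_coe, one_div, inv_inv]
    have h : ((1 + Real.exp b : ℝ) : ℂ) - 1 = ((Real.exp b : ℝ) : ℂ) := by push_cast; ring
    rw [h, ENNReal.log_pos_real (by simp) (by simp)]
    simp [Real.log_exp]

/-! ### Submersivity of the coordinates -/

theorem differentiable_homog (σ : MaxCone T) (ρ : Ray k l) :
    Differentiable ℝ (fun x : ChartSpace σ => homog σ x ρ) := by
  by_cases h : ρ ∈ σ.1
  · simp only [homog_of_mem σ _ h]; fun_prop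
  · simp only [homog_of_notMem σ _ h]; fun_prop

theorem differentiableAt_compactCoord {V ι : Type*} [NormedAddCommGroup V] [NormedSpace ℝ V]
    [Fintype ι] {f : ι → V → ℂ} {g : V → ℂ} {x : V} (hf : ∀ i, Differentiable ℝ (f i))
    (hg : Differentiable ℝ g) (hx : g x ≠ 0) :
    DifferentiableAt ℝ (fun y => compactCoord (logDistOne
      (if g y = 0 then OnePoint.infty else (((∏ i, f i y) / g y : ℂ) : OnePoint ℂ)))) x := by
  have h1 : (fun y => compactCoord (logDistOne
      (if g y = 0 then OnePoint.infty else (((∏ i, f i y) / g y : ℂ) : OnePoint ℂ)))) =ᶠ[𝓝 x]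
      fun y => ‖(∏ i, f i y) / g y - 1‖ ^ 2 / (1 + ‖(∏ i, f i y) / g y - 1‖ ^ 2) := by
    filter_upwards [hg.continuous.continuousAt.eventually_ne hx] with y hy
    rw [if_neg hy, compactCoord_logDistOne_coe]
  refine DifferentiableAt.congr_of_eventuallyEq ?_ h1
  have hprod : DifferentiableAt ℝ (fun y => ∏ i, f i y) x := by
    classical
    exact (HasFDerivAt.finsetProd fun i _ => (hf i x).hasFDerivAt).differentiableAt
  have h2 : DifferentiableAt ℝ (fun y => (∏ i, f i y) / g y - 1) x :=
    ((hprod.mul ((hg x).inv hx)).congr_of_eventuallyEq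
      (Eventually.of_forall fun y => div_eq_mul_inv _ _)).sub_const 1
  have h3 := h2.norm_sq ℝ
  exact (h3.mul ((h3.const_add 1).inv (by positivity))).congr_of_eventuallyEq
    (Eventually.of_forall fun y => div_eq_mul_inv _ _)

theorem hasDerivAt_compactCoord_line (R : ℝ) (hR : 0 ≤ R) :
    HasDerivAt (fun s : ℝ => (1 + s) ^ 2 * R / (1 + (1 + s) ^ 2 * R)) (2 * R / (1 + R) ^ 2) 0 := by
  have h1 : HasDerivAt (fun s : ℝ => (1 + s) ^ 2 * R) (2 * R) 0 := by
    have := (((hasDerivAt_id (0 : ℝ)).const_add 1).pow 2).mul_const R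
    simpa using this
  have h2 := h1.div (h1.const_add 1) (by positivity)
  refine h2.congr_deriv ?_
  simp
  ring

/-- A curve in a chart along which the quotient of a product of homogeneous coordinates by another
one moves on the line through `1`, and the other homogeneous coordinates are constant. -/
theorem exists_curve {ι : Type*} [Fintype ι] [DecidableEq ι] {v : ι → Ray k l}
    (hv : Function.Injective v) {r : Ray k l} {σ : MaxCone T}
    {x : ChartSpace σ} (hx : homog σ x r ≠ 0)
    (h : (r ∈ σ.1 ∧ ∀ i, v i ∉ σ.1) ∨
      (r ∉ σ.1 ∧ ∃ i, v i ∈ σ.1 ∧ ∀ i', i' ≠ i → homog σ x (v i') ≠ 0)) :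
    ∃ (γ : ℝ → ChartSpace σ) (γ' : ChartSpace σ), γ 0 = x ∧ HasDerivAt γ γ' 0 ∧
      (∀ s ρ, ρ ≠ r → (∀ i, v i ≠ ρ) → homog σ (γ s) ρ = homog σ x ρ) ∧
      ∀ᶠ s in 𝓝 (0 : ℝ), homog σ (γ s) r ≠ 0 ∧
        (∏ i, homog σ (γ s) (v i)) / homog σ (γ s) r =
          1 + (1 + s) * ((∏ i, homog σ x (v i)) / homog σ x r - 1) := by
  set z₀ := (∏ i, homog σ x (v i)) / homog σ x r with hz₀
  have hline : HasDerivAt (fun s : ℝ => 1 + (1 + (s : ℂ)) * (z₀ - 1)) (1 * (z₀ - 1)) 0 :=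
    (((Complex.ofRealCLM.hasDerivAt (x := (0 : ℝ))).const_add 1).mul_const (z₀ - 1)).const_add 1
  have hupd : ∀ (ρ : {ρ // ρ ∈ σ.1}) (c : ℂ) (ρ' : Ray k l), ρ' ≠ ρ →
      homog σ (Function.update x ρ c) ρ' = homog σ x ρ' := by
    intro ρ c ρ' h
    by_cases h' : ρ' ∈ σ.1
    · rw [homog_of_mem σ _ h', homog_of_mem σ _ h', Function.update_of_ne]
      exact fun e => h (congrArg Subtype.val e)
    · rw [homog_of_notMem σ _ h', homog_of_notMem σ _ h']
  have hself : ∀ (ρ : Ray k l) (h : ρ ∈ σ.1) (c : ℂ),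
      homog σ (Function.update x ⟨ρ, h⟩ c) ρ = c := by
    intro ρ h c
    rw [homog_of_mem σ _ h, Function.update_self]
  have hderiv : ∀ (ρ : {ρ // ρ ∈ σ.1}) {f : ℝ → ℂ} {f' : ℂ}, HasDerivAt f f' 0 →
      HasDerivAt (fun s => Function.update x ρ (f s)) (Pi.single ρ f') 0 := by
    intro ρ f f' hf
    rw [hasDerivAt_pi]
    intro ρ'
    by_cases e : ρ' = ρ
    · subst e; simpa using hf
    · simpa [e] using hasDerivAt_const (0 : ℝ) (x ρ')
  rcases h with ⟨hm, hnot⟩ | ⟨hm, i, hi, hne⟩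
  -- The quotient is the reciprocal of the coordinate of `r` here, so that coordinate follows the
  -- inverse of the prescribed line. It is defined for small $s$ because $z_0\neq0$.
  · have hprod : ∀ y : ChartSpace σ, ∏ i, homog σ y (v i) = 1 := fun y =>
      Finset.prod_eq_one fun i _ => homog_of_notMem σ y (hnot i)
    have hxr : homog σ x r = x ⟨r, hm⟩ := homog_of_mem σ x hm
    have hz : z₀ ≠ 0 := by rw [hz₀, hprod]; exact div_ne_zero one_ne_zero hx
    have hz' : 1 + (1 + ((0 : ℝ) : ℂ)) * (z₀ - 1) ≠ 0 := by simpa using hz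
    refine ⟨fun s => Function.update x ⟨r, hm⟩ (1 + (1 + (s : ℂ)) * (z₀ - 1))⁻¹, _, ?_,
      hderiv _ (hline.inv hz'), fun s ρ h _ => hupd _ _ _ h, ?_⟩
    · rw [Function.update_eq_self_iff, ← hxr]
      simp [hz₀, hprod]
    · filter_upwards [hline.continuousAt.eventually_ne hz'] with s hs
      rw [hself, hprod]
      exact ⟨inv_ne_zero hs, by rw [one_div, inv_inv]⟩
  -- The quotient is one coordinate times the factor `C` here, which is nonzero at `x` and constant
  -- along the curve. The coordinate may itself be $0$.
  · have hxr : ∀ y : ChartSpace σ, homog σ y r = 1 := fun y => homog_of_notMem σ y hm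
    set C := ∏ i' ∈ Finset.univ.erase i, homog σ x (v i') with hC
    have hC0 : C ≠ 0 := Finset.prod_ne_zero_iff.2 fun i' h => hne i' (Finset.ne_of_mem_erase h)
    have hprod : ∀ c : ℂ, ∏ i', homog σ (Function.update x ⟨v i, hi⟩ c) (v i') = c * C := by
      intro c
      rw [← Finset.mul_prod_erase _ _ (Finset.mem_univ i), hself]
      congr 1
      exact Finset.prod_congr rfl fun i' h =>
        hupd _ _ _ (hv.ne (Finset.ne_of_mem_erase h))
    have hx0 : z₀ = x ⟨v i, hi⟩ * C := by
      rw [hz₀, hxr, div_one, ← hprod, Function.update_eq_self]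
    refine ⟨fun s => Function.update x ⟨v i, hi⟩ ((1 + (1 + (s : ℂ)) * (z₀ - 1)) / C), _, ?_,
      hderiv _ (hline.div_const C), fun s ρ _ h => hupd _ _ _ (h i).symm, ?_⟩
    · rw [Function.update_eq_self_iff, hx0]
      field_simp
      simp
    · refine Eventually.of_forall fun s => ?_
      rw [hprod, hxr]
      refine ⟨one_ne_zero, ?_⟩
      rw [div_one, div_mul_cancel₀ _ hC0]

/-- Differentiability of `F` is not assumed, which allows its use at points with $z=\infty$ or
$w=\infty$ without a separate smoothness argument. -/
theorem not_surjective_fderiv {V E : Type*} [NormedAddCommGroup V] [NormedSpace ℝ V]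
    [NormedAddCommGroup E] [NormedSpace ℝ E] {F : V → E} {x : V} (L : E →L[ℝ] ℝ) (hL : L ≠ 0)
    (h : fderiv ℝ (fun y => L (F y)) x = 0) : ¬ Function.Surjective (fderiv ℝ F x) := by
  intro hs
  obtain ⟨e, he⟩ : ∃ e, L e ≠ 0 := by
    by_contra! h'
    exact hL (ContinuousLinearMap.ext h')
  obtain ⟨v, hv⟩ := hs e
  by_cases hd : DifferentiableAt ℝ F x
  · have h1 := (L.hasFDerivAt.comp x hd.hasFDerivAt).fderiv
    have h2 := congrArg (fun f => f v) (h1.symm.trans h)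
    simp only [ContinuousLinearMap.comp_apply, hv, zero_apply] at h2
    exact he h2
  -- Otherwise `fderiv` has its default value $0$, which is not surjective either, as `L` is
  -- nonzero.
  · rw [fderiv_zero_of_not_differentiableAt hd] at hv
    apply he
    rw [← hv]
    simp

theorem surjective_of_triangular {V : Type*} [AddCommGroup V] [Module ℝ V]
    (L : V →ₗ[ℝ] ℝ × ℝ × ℝ) {v₁ v₂ v₃ : V} (h₁ : (L v₁).1 ≠ 0) (h₁₂ : (L v₁).2.1 = 0)
    (h₂ : (L v₂).1 = 0) (h₂₂ : (L v₂).2.1 ≠ 0) (h₃ : (L v₃).1 = 0) (h₃₂ : (L v₃).2.1 = 0)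
    (h₃₃ : (L v₃).2.2 ≠ 0) : Function.Surjective L := by
  rintro ⟨a, b, c⟩
  refine ⟨(a / (L v₁).1) • v₁ + (b / (L v₂).2.1) • v₂ +
    ((c - a / (L v₁).1 * (L v₁).2.2 - b / (L v₂).2.1 * (L v₂).2.2) / (L v₃).2.2) • v₃, ?_⟩
  simp only [map_add, map_smul]
  ext
  · simp [h₂, h₃, h₁]
  · simp [h₁₂, h₂₂, h₃₂]
  · simp
    field_simp
    ring

end Fibration

/-! ### The discriminant locus -/

section Discriminant

variable {T : MaximalTriangulation k l} {ω : ToricKahlerForm T} {μ : ToricVariety T → ℝ}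

theorem zFun_chart (σ : MaxCone T) (x : ChartSpace σ) : zFun (chart σ x) =
    if homog σ x Ray.zInf = 0 then OnePoint.infty
    else (((∏ i, homog σ x (Ray.bot i)) / homog σ x Ray.zInf : ℂ) : OnePoint ℂ) :=
  zFun_toPoint _

theorem wFun_chart (σ : MaxCone T) (x : ChartSpace σ) : wFun (chart σ x) =
    if homog σ x Ray.wInf = 0 then OnePoint.infty
    else (((∏ j, homog σ x (Ray.top j)) / homog σ x Ray.wInf : ℂ) : OnePoint ℂ) :=
  wFun_toPoint _

/-- Scaling acts only on the `Ray.xiZero` coordinate, which does not occur in $z$. Since `c` is any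
unit, this covers the real flow as well as the circle. -/
theorem zFun_chart_zpow_mul {σ : MaxCone T} {a : Ray k l → ℤ} (ha : IsCoeff σ ![1, 0, 0] a)
    (c : ℂˣ) (x : ChartSpace σ) : zFun (chart σ fun ρ => (c : ℂ) ^ a ρ * x ρ) = zFun (chart σ x) := by
  rw [chart_zpow_mul_eq_toPoint ha, zFun_toPoint, zFun_chart]
  simp

theorem wFun_chart_zpow_mul {σ : MaxCone T} {a : Ray k l → ℤ} (ha : IsCoeff σ ![1, 0, 0] a)
    (c : ℂˣ) (x : ChartSpace σ) : wFun (chart σ fun ρ => (c : ℂ) ^ a ρ * x ρ) = wFun (chart σ x) := by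
  rw [chart_zpow_mul_eq_toPoint ha, wFun_toPoint, wFun_chart]
  simp

theorem hasDerivAt_zpow_mul (σ : MaxCone T) (a : Ray k l → ℤ) (x : ChartSpace σ) :
    HasDerivAt (fun s : ℝ => (fun ρ => (Complex.exp s) ^ a ρ * x ρ : ChartSpace σ))
      (flowVector σ a x) 0 := by
  rw [hasDerivAt_pi]
  intro ρ
  have h1 : HasDerivAt (fun s : ℝ => Complex.exp ((s : ℂ) * a ρ)) (1 * a ρ : ℂ) 0 := by
    have h2 : HasDerivAt (fun s : ℝ => (s : ℂ) * a ρ) (1 * a ρ : ℂ) 0 :=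
      (Complex.ofRealCLM.hasDerivAt (x := (0 : ℝ))).mul_const _
    simpa using h2.cexp
  have h3 : (fun s : ℝ => (Complex.exp s) ^ a ρ * x ρ) =
      fun s : ℝ => Complex.exp ((s : ℂ) * a ρ) * x ρ := by
    funext s
    rw [← Complex.exp_int_mul, mul_comm (s : ℂ)]
  rw [h3]
  simpa [flowVector] using h1.mul_const (x ρ)

/-- A function of a curve that moves on the line through `1`, in the coordinate of the base. -/
theorem hasDerivAt_compactCoord_logDistOne {ζ : ℝ → OnePoint ℂ} {z₀ : ℂ}
    (h : ∀ᶠ s in 𝓝 (0 : ℝ), ζ s = ((1 + (1 + s) * (z₀ - 1) : ℂ) : OnePoint ℂ)) :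
    HasDerivAt (fun s => compactCoord (logDistOne (ζ s)))
      (2 * ‖z₀ - 1‖ ^ 2 / (1 + ‖z₀ - 1‖ ^ 2) ^ 2) 0 := by
  refine (hasDerivAt_compactCoord_line (‖z₀ - 1‖ ^ 2) (by positivity)).congr_of_eventuallyEq ?_
  filter_upwards [h] with s hs
  rw [hs, compactCoord_logDistOne_coe, add_sub_cancel_left, norm_mul, mul_pow]
  have : ‖(1 + s : ℂ)‖ ^ 2 = (1 + s) ^ 2 := by
    rw [← Complex.ofReal_one, ← Complex.ofReal_add, Complex.norm_real, Real.norm_eq_abs, sq_abs]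
  rw [this]

namespace IsCircleMomentMap

/-- If two of the lower coordinates vanished, the point would lie on a fixed curve, where $d\mu=0$.
So at most one factor of $z$ vanishes, as the curve that moves $z$ requires. -/
theorem bot_condition_of_fderiv_ne_zero (hμ : IsCircleMomentMap ω μ) {σ : MaxCone T} {x : ChartSpace σ}
    (h : fderiv ℝ (fun y => μ (chart σ y)) x ≠ 0) :
    (Ray.zInf ∈ σ.1 ∧ ∀ i, Ray.bot i ∉ σ.1) ∨
      (Ray.zInf ∉ σ.1 ∧ ∃ i, Ray.bot i ∈ σ.1 ∧ ∀ i', i' ≠ i → homog σ x (Ray.bot i') ≠ 0) := by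
  have hone : ∀ ρ, ρ ∉ σ.1 → homog σ x ρ ≠ 0 := fun ρ h => by
    rw [homog_of_notMem σ x h]; exact one_ne_zero
  rcases σ.2.bot_cases with h1 | ⟨h0, i, hi, hi'⟩ | ⟨h0, i, h1, h2, h3⟩
  · exact Or.inl h1
  · exact Or.inr ⟨h0, i, hi, fun i' h => hone _ (hi' i' h)⟩
  · refine Or.inr ⟨h0, ?_⟩
    by_cases hx : homog σ x (Ray.bot i.castSucc) = 0
    · refine ⟨i.castSucc, h1, fun i' hi' => ?_⟩
      by_cases e : i' = i.succ
      · subst e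
        intro hx'
        rw [homog_of_mem σ x h1] at hx
        rw [homog_of_mem σ x h2] at hx'
        exact h (hμ.fderiv_eq_zero_of_bot h1 h2 hx hx')
      · exact hone _ (h3 i' hi' e)
    · refine ⟨i.succ, h2, fun i' hi' => ?_⟩
      by_cases e : i' = i.castSucc
      · rwa [e]
      · exact hone _ (h3 i' e hi')

theorem top_condition_of_fderiv_ne_zero (hμ : IsCircleMomentMap ω μ) {σ : MaxCone T} {x : ChartSpace σ}
    (h : fderiv ℝ (fun y => μ (chart σ y)) x ≠ 0) :
    (Ray.wInf ∈ σ.1 ∧ ∀ j, Ray.top j ∉ σ.1) ∨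
      (Ray.wInf ∉ σ.1 ∧ ∃ j, Ray.top j ∈ σ.1 ∧ ∀ j', j' ≠ j → homog σ x (Ray.top j') ≠ 0) := by
  have hone : ∀ ρ, ρ ∉ σ.1 → homog σ x ρ ≠ 0 := fun ρ h => by
    rw [homog_of_notMem σ x h]; exact one_ne_zero
  rcases σ.2.top_cases with h1 | ⟨h0, i, hi, hi'⟩ | ⟨h0, i, h1, h2, h3⟩
  · exact Or.inl h1
  · exact Or.inr ⟨h0, i, hi, fun i' h => hone _ (hi' i' h)⟩
  · refine Or.inr ⟨h0, ?_⟩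
    by_cases hx : homog σ x (Ray.top i.castSucc) = 0
    · refine ⟨i.castSucc, h1, fun i' hi' => ?_⟩
      by_cases e : i' = i.succ
      · subst e
        intro hx'
        rw [homog_of_mem σ x h1] at hx
        rw [homog_of_mem σ x h2] at hx'
        exact h (hμ.fderiv_eq_zero_of_top h1 h2 hx hx')
      · exact hone _ (h3 i' hi' e)
    · refine ⟨i.succ, h2, fun i' hi' => ?_⟩
      by_cases e : i' = i.castSucc
      · rwa [e]
      · exact hone _ (h3 i' e hi')

/-- The fibration is a submersion at the points that are not fixed by the circle action and at which
`z` and `w` are different from `1` and `∞`. -/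
theorem surjective_fderiv (hμ : IsCircleMomentMap ω μ) {σ : MaxCone T} {x : ChartSpace σ}
    (hμx : fderiv ℝ (fun y => μ (chart σ y)) x ≠ 0) {z₀ w₀ : ℂ}
    (hz : zFun (chart σ x) = (z₀ : OnePoint ℂ)) (hw : wFun (chart σ x) = (w₀ : OnePoint ℂ))
    (hz1 : z₀ ≠ 1) (hw1 : w₀ ≠ 1) :
    Function.Surjective (fderiv ℝ (fun y => baseCoord (fibration μ (chart σ y))) x) := by
  set F : ChartSpace σ → ℝ × ℝ × ℝ := fun y => baseCoord (fibration μ (chart σ y)) with hF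
  have hzInf : homog σ x Ray.zInf ≠ 0 := by
    intro h; rw [zFun_chart, if_pos h] at hz; exact OnePoint.infty_ne_coe _ hz
  have hwInf : homog σ x Ray.wInf ≠ 0 := by
    intro h; rw [wFun_chart, if_pos h] at hw; exact OnePoint.infty_ne_coe _ hw
  rw [zFun_chart, if_neg hzInf, OnePoint.coe_eq_coe] at hz
  rw [wFun_chart, if_neg hwInf, OnePoint.coe_eq_coe] at hw
  have hd : DifferentiableAt ℝ F x := by
    refine DifferentiableAt.prodMk ?_ (DifferentiableAt.prodMk ?_ (hμ.differentiable_chart σ x))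
    · refine (differentiableAt_compactCoord (fun i => differentiable_homog σ (Ray.bot i))
        (differentiable_homog σ Ray.zInf) hzInf).congr_of_eventuallyEq (Eventually.of_forall fun y => ?_)
      exact congrArg (fun ζ => compactCoord (logDistOne ζ)) (zFun_chart σ y)
    · refine (differentiableAt_compactCoord (fun i => differentiable_homog σ (Ray.top i))
        (differentiable_homog σ Ray.wInf) hwInf).congr_of_eventuallyEq (Eventually.of_forall fun y => ?_)
      exact congrArg (fun ζ => compactCoord (logDistOne ζ)) (wFun_chart σ y)
  have hcurve : ∀ {γ : ℝ → ChartSpace σ} {γ' : ChartSpace σ}, γ 0 = x → HasDerivAt γ γ' 0 →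
      HasDerivAt (fun s => compactCoord (logDistOne (zFun (chart σ (γ s))))) (fderiv ℝ F x γ').1 0 ∧
      HasDerivAt (fun s => compactCoord (logDistOne (wFun (chart σ (γ s)))))
        (fderiv ℝ F x γ').2.1 0 ∧
      HasDerivAt (fun s => μ (chart σ (γ s))) (fderiv ℝ F x γ').2.2 0 := by
    intro γ γ' h0 hγ
    have h1 : HasDerivAt (fun s => F (γ s)) (fderiv ℝ F x γ') 0 := by
      subst h0
      exact hd.hasFDerivAt.comp_hasDerivAt (0 : ℝ) hγ
    have h2 := (hasFDerivAt_snd (𝕜 := ℝ) (p := F (γ 0))).comp_hasDerivAt (0 : ℝ) h1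
    have h3 := (hasFDerivAt_fst (𝕜 := ℝ) (p := F (γ 0))).comp_hasDerivAt (0 : ℝ) h1
    have h4 := (hasFDerivAt_fst (𝕜 := ℝ) (p := (F (γ 0)).2)).comp_hasDerivAt (0 : ℝ) h2
    have h5 := (hasFDerivAt_snd (𝕜 := ℝ) (p := (F (γ 0)).2)).comp_hasDerivAt (0 : ℝ) h2
    exact ⟨h3, h4, h5⟩
  have hpos : ∀ {z : ℂ}, z ≠ 1 → 2 * ‖z - 1‖ ^ 2 / (1 + ‖z - 1‖ ^ 2) ^ 2 ≠ 0 := by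
    intro z h
    have : 0 < ‖z - 1‖ := norm_pos_iff.2 (sub_ne_zero.2 h)
    positivity
  obtain ⟨γ₁, γ₁', h₁0, h₁d, h₁c, h₁⟩ := exists_curve (v := Ray.bot) (r := Ray.zInf)
    (fun i i' h => by simpa using h) hzInf (hμ.bot_condition_of_fderiv_ne_zero hμx)
  obtain ⟨γ₂, γ₂', h₂0, h₂d, h₂c, h₂⟩ := exists_curve (v := Ray.top) (r := Ray.wInf)
    (fun i i' h => by simpa using h) hwInf (hμ.top_condition_of_fderiv_ne_zero hμx)
  rw [hz] at h₁
  rw [hw] at h₂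
  obtain ⟨a, ha⟩ := exists_isCoeff_circle σ
  have hflow : flowVector σ a x ≠ 0 := fun h => hμx (hμ.fderiv_eq_zero ha h)
  obtain ⟨c₁, c₁', -⟩ := hcurve h₁0 h₁d
  obtain ⟨c₂, c₂', -⟩ := hcurve h₂0 h₂d
  obtain ⟨c₃, c₃', c₃''⟩ := hcurve (by ext; simp) (hasDerivAt_zpow_mul σ a x)
  -- The first curve fixes $w$, the second fixes $z$, and the gradient flow fixes both. The effect
  -- of the first two on $\mu$ is irrelevant.
  refine surjective_of_triangular (fderiv ℝ F x).toLinearMap (v₁ := γ₁') (v₂ := γ₂')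
    (v₃ := flowVector σ a x) ?_ ?_ ?_ ?_ ?_ ?_ ?_
  · have := c₁.unique (hasDerivAt_compactCoord_logDistOne (z₀ := z₀) (by
      filter_upwards [h₁] with s hs
      rw [zFun_chart, if_neg hs.1, hs.2]))
    exact fun h => hpos hz1 (this.symm.trans h)
  · have hc : (fun s => compactCoord (logDistOne (wFun (chart σ (γ₁ s))))) =
        fun _ => compactCoord (logDistOne (wFun (chart σ x))) := by
      funext s
      simp only [wFun_chart, h₁c s Ray.wInf (by simp) (by simp),
        fun j => h₁c s (Ray.top j) (by simp) (by simp)]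
    rw [hc] at c₁'
    exact c₁'.unique (hasDerivAt_const _ _)
  · have hc : (fun s => compactCoord (logDistOne (zFun (chart σ (γ₂ s))))) =
        fun _ => compactCoord (logDistOne (zFun (chart σ x))) := by
      funext s
      simp only [zFun_chart, h₂c s Ray.zInf (by simp) (by simp),
        fun j => h₂c s (Ray.bot j) (by simp) (by simp)]
    rw [hc] at c₂
    exact c₂.unique (hasDerivAt_const _ _)
  · have := c₂'.unique (hasDerivAt_compactCoord_logDistOne (z₀ := w₀) (by
      filter_upwards [h₂] with s hs
      rw [wFun_chart, if_neg hs.1, hs.2]))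
    exact fun h => hpos hw1 (this.symm.trans h)
  · have hc : (fun s : ℝ => compactCoord (logDistOne (zFun (chart σ
        fun ρ => (Complex.exp s) ^ a ρ * x ρ)))) =
        fun _ => compactCoord (logDistOne (zFun (chart σ x))) := by
      funext s
      rw [← zFun_chart_zpow_mul ha (Units.mk0 _ (Complex.exp_ne_zero s)) x, Units.val_mk0]
    rw [hc] at c₃
    exact c₃.unique (hasDerivAt_const _ _)
  · have hc : (fun s : ℝ => compactCoord (logDistOne (wFun (chart σ
        fun ρ => (Complex.exp s) ^ a ρ * x ρ)))) =
        fun _ => compactCoord (logDistOne (wFun (chart σ x))) := by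
      funext s
      rw [← wFun_chart_zpow_mul ha (Units.mk0 _ (Complex.exp_ne_zero s)) x, Units.val_mk0]
    rw [hc] at c₃'
    exact c₃'.unique (hasDerivAt_const _ _)
  · have h0 : (fun ρ => Complex.exp ((0 : ℝ) : ℂ) ^ a ρ * x ρ : ChartSpace σ) = x := by ext; simp
    have h1 := ((hμ.differentiable_chart σ _).hasFDerivAt).comp_hasDerivAt (0 : ℝ)
      (hasDerivAt_zpow_mul σ a x)
    rw [h0] at h1
    have h2 := c₃''.unique h1
    exact fun h => (hμ.fderiv_flowVector_pos ha hflow).ne' (h2.symm.trans h)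

/-- A point over the boundary of the base is a critical point of the fibration. -/
theorem isCriticalPoint_of_mem_baseBoundary (hμ : IsCircleMomentMap ω μ) {p : ToricVariety T}
    (hp : fibration μ p ∈ baseBoundary μ) :
    IsCriticalPoint (fun q => baseCoord (fibration μ q)) p := by
  obtain ⟨σ, x, rfl⟩ := exists_chart_eq p
  refine ⟨σ, x, rfl, ?_⟩
  have hQ := compactCoord_logDistOne_mem_Icc
  obtain ⟨-, h⟩ := hp
  have hL1 : ContinuousLinearMap.fst ℝ ℝ (ℝ × ℝ) ≠ 0 := fun h => by
    simpa using congrArg (fun f => f (1, 0, 0)) h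
  have hL2 : (ContinuousLinearMap.fst ℝ ℝ ℝ).comp (ContinuousLinearMap.snd ℝ ℝ (ℝ × ℝ)) ≠ 0 :=
    fun h => by simpa using congrArg (fun f => f (0, 1, 0)) h
  have hL3 : (ContinuousLinearMap.snd ℝ ℝ ℝ).comp (ContinuousLinearMap.snd ℝ ℝ (ℝ × ℝ)) ≠ 0 :=
    fun h => by simpa using congrArg (fun f => f (0, 0, 1)) h
  -- Each coordinate of the base takes values in a closed interval, and over the boundary one of
  -- them sits at an endpoint, so it has a local extremum there.
  have hext : ∀ {f : ChartSpace σ → ℝ} {c d : ℝ}, (∀ y, f y ∈ Icc c d) → f x = c ∨ f x = d →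
      fderiv ℝ f x = 0 := by
    rintro f c d hf (h | h)
    · exact IsLocalMin.fderiv_eq_zero (Eventually.of_forall fun y => h ▸ (hf y).1)
    · exact IsLocalMax.fderiv_eq_zero (Eventually.of_forall fun y => h ▸ (hf y).2)
  have hz : (fibration μ (chart σ x)).1 = logDistOne (zFun (chart σ x)) := rfl
  have hw : (fibration μ (chart σ x)).2.1 = logDistOne (wFun (chart σ x)) := rfl
  rw [hz, hw] at h
  have hcases : (compactCoord (logDistOne (zFun (chart σ x))) = 0 ∨
      compactCoord (logDistOne (zFun (chart σ x))) = 1) ∨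
      (compactCoord (logDistOne (wFun (chart σ x))) = 0 ∨
      compactCoord (logDistOne (wFun (chart σ x))) = 1) ∨
      (μ (chart σ x) = minValue μ ∨ μ (chart σ x) = maxValue μ) := by
    rcases h with h | h | h | h | h
    · exact Or.inl (Or.inl (by rw [h, compactCoord_bot]))
    · exact Or.inl (Or.inr (by rw [h, compactCoord_top]))
    · exact Or.inr (Or.inl (Or.inl (by rw [h, compactCoord_bot])))
    · exact Or.inr (Or.inl (Or.inr (by rw [h, compactCoord_top])))
    · rw [hμ.range_eq_Icc, frontier_Icc hμ.minValue_lt_maxValue.le] at h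
      exact Or.inr (Or.inr h)
  rcases hcases with h | h | h
  · exact not_surjective_fderiv _ hL1 (hext (fun y => hQ (zFun (chart σ y))) h)
  · exact not_surjective_fderiv _ hL2 (hext (fun y => hQ (wFun (chart σ y))) h)
  · exact not_surjective_fderiv _ hL3 (hext (fun y => hμ.mem_Icc (chart σ y)) h)

theorem isCriticalPoint_of_fderiv_eq_zero {σ : MaxCone T} {x : ChartSpace σ}
    (h : fderiv ℝ (fun y => μ (chart σ y)) x = 0) :
    IsCriticalPoint (fun q => baseCoord (fibration μ q)) (chart σ x) := by
  refine ⟨σ, x, rfl, not_surjective_fderiv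
    ((ContinuousLinearMap.snd ℝ ℝ ℝ).comp (ContinuousLinearMap.snd ℝ ℝ (ℝ × ℝ))) ?_ h⟩
  exact fun h => by simpa using congrArg (fun f => f (0, 0, 1)) h

/-- The fibration maps onto its base. -/
theorem exists_fibration_eq (hμ : IsCircleMomentMap ω μ) {b : EReal × EReal × ℝ}
    (hb : b ∈ base μ) : ∃ p, fibration μ p = b := by
  obtain ⟨b₁, b₂, m⟩ := b
  obtain ⟨y, hy⟩ := exists_logDistOne_inv_eq b₁
  obtain ⟨v, hv⟩ := exists_logDistOne_inv_eq b₂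
  have hm : m ∈ Icc (minValue μ) (maxValue μ) := hμ.range_eq_Icc ▸ hb
  obtain ⟨u, hu, h1, hz, hw⟩ := hμ.exists_homogCoord_eq y v hm
  refine ⟨toPoint u, ?_⟩
  simp only [fibration, zFun_toPoint, wFun_toPoint, h1, hz, hw, hu, Finset.prod_const_one, hy, hv]

theorem mem_discriminantLocus_of_bot (hμ : IsCircleMomentMap ω μ) (i : Fin k) {b : EReal × EReal × ℝ}
    (h1 : b.1 = 0) (h3 : b.2.2 = botValue μ i) : b ∈ discriminantLocus μ := by
  obtain ⟨b₁, b₂, m⟩ := b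
  simp only at h1 h3
  obtain ⟨y, hy⟩ := exists_logDistOne_inv_eq b₂
  -- The remaining coordinate parametrizes the fixed curve; on it $z=0$ and $w=1/y$, so $\log|w-1|$
  -- can be given any value.
  let x : ChartSpace (coneBotEdge T i) := fun ρ => if ρ.1 = Ray.wInf then y else 0
  have hc : (Ray.bot i.castSucc : Ray k l) ∈ (coneBotEdge T i).1 := by simp
  have hs : (Ray.bot i.succ : Ray k l) ∈ (coneBotEdge T i).1 := by simp
  have hx : x ⟨_, hc⟩ = 0 := by simp [x]
  have hx' : x ⟨_, hs⟩ = 0 := by simp [x]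
  refine ⟨_, isCriticalPoint_of_fderiv_eq_zero (hμ.fderiv_eq_zero_of_bot hc hs hx hx'), ?_⟩
  have hz : homog _ x Ray.zInf = 1 := homog_of_notMem _ _ (by simp)
  have hw : homog _ x Ray.wInf = y := (homog_of_mem _ _ (by simp)).trans (by simp [x])
  have hb : ∏ i, homog _ x (Ray.bot i) = 0 :=
    Finset.prod_eq_zero (Finset.mem_univ i.castSucc) ((homog_of_mem _ _ hc).trans hx)
  have ht : ∏ j, homog _ x (Ray.top j) = 1 :=
    Finset.prod_eq_one fun j _ => homog_of_notMem _ _ (by simp)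
  simp only [fibration, zFun_chart, wFun_chart, hz, hw, hb, ht, hμ.eq_botValue hc hs hx hx', h1, h3,
    hy, one_ne_zero, if_false, zero_div, logDistOne_zero]

theorem mem_discriminantLocus_of_top (hμ : IsCircleMomentMap ω μ) (j : Fin l) {b : EReal × EReal × ℝ}
    (h2 : b.2.1 = 0) (h3 : b.2.2 = topValue μ j) : b ∈ discriminantLocus μ := by
  obtain ⟨b₁, b₂, m⟩ := b
  simp only at h2 h3
  obtain ⟨y, hy⟩ := exists_logDistOne_inv_eq b₁
  let x : ChartSpace (coneTopEdge T j) := fun ρ => if ρ.1 = Ray.zInf then y else 0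
  have hc : (Ray.top j.castSucc : Ray k l) ∈ (coneTopEdge T j).1 := by simp
  have hs : (Ray.top j.succ : Ray k l) ∈ (coneTopEdge T j).1 := by simp
  have hx : x ⟨_, hc⟩ = 0 := by simp [x]
  have hx' : x ⟨_, hs⟩ = 0 := by simp [x]
  refine ⟨_, isCriticalPoint_of_fderiv_eq_zero (hμ.fderiv_eq_zero_of_top hc hs hx hx'), ?_⟩
  have hw : homog _ x Ray.wInf = 1 := homog_of_notMem _ _ (by simp)
  have hz : homog _ x Ray.zInf = y := (homog_of_mem _ _ (by simp)).trans (by simp [x])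
  have ht : ∏ j, homog _ x (Ray.top j) = 0 :=
    Finset.prod_eq_zero (Finset.mem_univ j.castSucc) ((homog_of_mem _ _ hc).trans hx)
  have hb : ∏ i, homog _ x (Ray.bot i) = 1 :=
    Finset.prod_eq_one fun j _ => homog_of_notMem _ _ (by simp)
  simp only [fibration, zFun_chart, wFun_chart, hz, hw, hb, ht, hμ.eq_topValue hc hs hx hx', h2, h3,
    hy, one_ne_zero, if_false, zero_div, logDistOne_zero]

theorem wall_of_mem_discriminantLocus (hμ : IsCircleMomentMap ω μ) {b : EReal × EReal × ℝ}
    (hb : b ∈ discriminantLocus μ) (hb' : b ∉ baseBoundary μ) :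
    b ∈ base μ ∧ ((∃ i : Fin k, b.1 = 0 ∧ b.2.2 = botValue μ i) ∨
      ∃ j : Fin l, b.2.1 = 0 ∧ b.2.2 = topValue μ j) := by
  obtain ⟨_, ⟨σ, x, rfl, hx⟩, rfl⟩ := hb
  have hbase : fibration μ (chart σ x) ∈ base μ := ⟨_, rfl⟩
  refine ⟨hbase, ?_⟩
  have hnot : ¬ ((fibration μ (chart σ x)).1 = ⊥ ∨ (fibration μ (chart σ x)).1 = ⊤ ∨
      (fibration μ (chart σ x)).2.1 = ⊥ ∨ (fibration μ (chart σ x)).2.1 = ⊤ ∨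
      (fibration μ (chart σ x)).2.2 ∈ frontier (range μ)) := fun h => hb' ⟨hbase, h⟩
  simp only [not_or, fibration] at hnot ⊢
  rw [hμ.range_eq_Icc, frontier_Icc hμ.minValue_lt_maxValue.le] at hnot
  simp only [mem_insert_iff, mem_singleton_iff, not_or] at hnot
  obtain ⟨hz, hz', hw, hw', hm, hm'⟩ := hnot
  have hfin : ∀ {ζ : OnePoint ℂ}, logDistOne ζ ≠ ⊥ → logDistOne ζ ≠ ⊤ →
      ∃ a : ℂ, ζ = (a : OnePoint ℂ) ∧ a ≠ 1 := by
    intro ζ h1 h2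
    induction ζ using OnePoint.rec with
    | infty => exact absurd rfl h2
    | coe a =>
      refine ⟨a, rfl, ?_⟩
      rintro rfl
      apply h1
      simp [logDistOne_coe]
  obtain ⟨z₀, hz₀, hz1⟩ := hfin hz hz'
  obtain ⟨w₀, hw₀, hw1⟩ := hfin hw hw'
  -- Off the boundary, $z$ and $w$ avoid $1$ and $\infty$, so submersivity can fail only where
  -- $d\mu=0$.
  have hcrit : fderiv ℝ (fun y => μ (chart σ y)) x = 0 := by
    by_contra h
    exact hx (hμ.surjective_fderiv h hz₀ hw₀ hz1 hw1)
  rcases hμ.critical_cases hcrit with h | h | ⟨i, hi, h⟩ | ⟨j, hj, h⟩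
  · exact absurd h hm
  · exact absurd h hm'
  · refine Or.inl ⟨i, ?_, h⟩
    -- On this curve the numerator of $z$ vanishes, so $z=0$ once $\infty$ is excluded, and
    -- $\log|0-1|=0$.
    have hb : ∏ i, homog σ x (Ray.bot i) = 0 := Finset.prod_eq_zero (Finset.mem_univ _) hi
    rw [zFun_chart, hb, zero_div] at hz' ⊢
    by_cases hc : homog σ x Ray.zInf = 0
    · rw [if_pos hc] at hz'
      exact absurd rfl hz'
    · rw [if_neg hc, logDistOne_zero]
  · refine Or.inr ⟨j, ?_, h⟩
    have hb : ∏ j, homog σ x (Ray.top j) = 0 := Finset.prod_eq_zero (Finset.mem_univ _) hj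
    rw [wFun_chart, hb, zero_div] at hw' ⊢
    by_cases hc : homog σ x Ray.wInf = 0
    · rw [if_pos hc] at hw'
      exact absurd rfl hw'
    · rw [if_neg hc, logDistOne_zero]

theorem discriminantLocus_eq (hμ : IsCircleMomentMap ω μ) :
    discriminantLocus μ = baseBoundary μ ∪
      (⋃ i : Fin k, {b | b ∈ base μ ∧ b.1 = 0 ∧ b.2.2 = botValue μ i}) ∪
      (⋃ j : Fin l, {b | b ∈ base μ ∧ b.2.1 = 0 ∧ b.2.2 = topValue μ j}) := by
  ext b
  simp only [mem_union, mem_iUnion, mem_ofPred_eq]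
  constructor
  · intro hb
    by_cases hb' : b ∈ baseBoundary μ
    · exact Or.inl (Or.inl hb')
    · obtain ⟨h, ⟨i, hi⟩ | ⟨j, hj⟩⟩ := hμ.wall_of_mem_discriminantLocus hb hb'
      · exact Or.inl (Or.inr ⟨i, h, hi⟩)
      · exact Or.inr ⟨j, h, hj⟩
  · rintro ((hb | ⟨i, -, h1, h3⟩) | ⟨j, -, h2, h3⟩)
    · obtain ⟨p, rfl⟩ := hμ.exists_fibration_eq hb.1
      exact ⟨p, hμ.isCriticalPoint_of_mem_baseBoundary hb, rfl⟩
    · exact hμ.mem_discriminantLocus_of_bot i h1 h3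
    · exact hμ.mem_discriminantLocus_of_top j h2 h3

end IsCircleMomentMap

end Discriminant


end DoubledGross

end

theorem mainTheorem11 (k l : ℕ) (hl : 1 ≤ l) (hkl : l ≤ k)
    (T : DoubledGross.MaximalTriangulation k l) (ω : DoubledGross.ToricKahlerForm T)
    (μ : DoubledGross.ToricVariety T → ℝ) (hμ : DoubledGross.IsCircleMomentMap ω μ) :
    (∃ c d : ℝ, c < d ∧ Set.range μ = Set.Icc c d) ∧
    ∃ (s : Fin k → ℝ) (t : Fin l → ℝ),
      (∀ (i : Fin k), ∀ p ∈ DoubledGross.toricDivisor T (DoubledGross.Ray.bot i.castSucc) ∩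
        DoubledGross.toricDivisor T (DoubledGross.Ray.bot i.succ), μ p = s i) ∧
      (∀ (j : Fin l), ∀ p ∈ DoubledGross.toricDivisor T (DoubledGross.Ray.top j.castSucc) ∩
        DoubledGross.toricDivisor T (DoubledGross.Ray.top j.succ), μ p = t j) ∧
      Function.Injective (Sum.elim s t) ∧
      DoubledGross.criticalValues μ ∩ interior (Set.range μ) = Set.range s ∪ Set.range t ∧
      DoubledGross.discriminantLocus μ =
        DoubledGross.baseBoundary μ ∪
          (⋃ i : Fin k, {b | b ∈ DoubledGross.base μ ∧ b.1 = 0 ∧ b.2.2 = s i}) ∪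
          (⋃ j : Fin l, {b | b ∈ DoubledGross.base μ ∧ b.2.1 = 0 ∧ b.2.2 = t j}) := by
  have hk : 0 < k + l := by omega
  exact ⟨⟨_, _, hμ.minValue_lt_maxValue, hμ.range_eq_Icc⟩,
    DoubledGross.botValue μ, DoubledGross.topValue μ,
    fun i _ hp => hμ.eq_botValue_of_mem_toricDivisor i hp.1 hp.2,
    fun j _ hp => hμ.eq_topValue_of_mem_toricDivisor j hp.1 hp.2,
    hμ.injective_elim hk, hμ.criticalValues_inter_interior hk, hμ.discriminantLocus_eq⟩
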